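/- Conventions. Let $n\ge 1$, $d\ge 0$. A weighted simplicial complex (wsc) on $[n]=\{1,\dots,n\}$ is a function $\Omega:\mathcal P([n])\to\mathbb N$ such that $\Omega(S_1)$ divides $\Omega(S_2)$ whenever $S_1\subseteq S_2$, and $\Omega(\{i\})\neq 0$ for all $i$. A facet is an inclusion-maximal set $F$ with $\Omega(F)\ne 0$; $\widetilde{\mathcal F}$ is the multiset of facets in which $F$ occurs $\Omega(F)$ times, and $\widetilde{\mathcal F}_i$ consists of the members of $\widetilde{\mathcal F}$ that contain $i$. We call $\Omega$ a tree if all its values are $0$ or $1$, every facet has at most two elements, and the graph on $[n]$ whose edges are the two-element facets is connected and has no cycles. For a finite index set $\mathcal I$ with $r$ elements and $\alpha\in\mathcal I^{\widetilde{\mathcal F}}$ let $\alpha_{|_i}\in\mathcal I^{\widetilde{\mathcal F}_i}$ be its restriction. An $\Omega$-decomposition of size $r$ of $L\in\mathcal M_{d,d'}(\mathbb C)^{\otimes n}$ is a family $A^{[i]}_\beta\in\mathcal M_{d,d'}(\mathbb C)$ ($i\in[n]$, $\beta\in\mathcal I^{\widetilde{\mathcal F}_i}$) with $L=\sum_{\alpha\in\mathcal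 I^{\widetilde{\mathcal F}}}A^{[1]}_{\alpha_{|_1}}\otimes\cdots\otimes A^{[n]}_{\alpha_{|_n}}$. It is separable if $d=d'$ and all $A^{[i]}_\beta$ are positive semidefinite (psd). An $\Omega$-purification of size $r$ of $\rho\in\mathcal M_d(\mathbb C)^{\otimes n}$ is a factorization $\rho=LL^\dagger$ with $L\in\mathcal M_{d,d'}(\mathbb C)^{\otimes n}$ for some $d'$, together with an $\Omega$-decomposition of $L$ of size $r$. For $T\in(\mathbb C^d)^{\otimes n}$, a nonnegative $\Omega$-decomposition of size $r$ is a family of entrywise nonnegative vectors $v^{[i]}_\beta\in\mathbb C^d$ with $T=\sum_\alpha v^{[1]}_{\alpha_{|_1}}\otimes\cdots\otimes v^{[n]}_{\alpha_{|_n}}$; a psd $\Omega$-decomposition of size $r$ is a family of psd matrices $E^{[i]}_j$ ($i\in[n]$, $j\in[d]$) with rows and columns indexed by $\mathcal I^{\widetilde{\mathcal F}_i}$ such that $T_{j_1,\dots,j_n}=\sum_{\alpha,\alpha'}\prod_{i=1}^n (E^{[i]}_{j_i})_{\alpha_{|_i},\alpha'_{|_i}}$ for all $j_1,\dots,j_n$.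 The ranks $\operatorname{nn-rank}_\Omega(T)$, $\operatorname{psd-rank}_\Omega(T)$, $\operatorname{sep-rank}_\Omega(\rho)$, $\operatorname{puri-rank}_\Omega(\rho)$ are the least sizes $r\in\mathbb N$ of, respectively, a nonnegative $\Omega$-decomposition, a psd $\Omega$-decomposition, a separable $\Omega$-decomposition and an $\Omega$-purification ($\infty$ if there is none). The border rank of $x$ belonging to any of these ranks (denoted by an underline) is the least $s$ such that some sequence $x_k\to x$ in the same space satisfies $\operatorname{rank}(x_k)\le s$ for all $k$. A matrix $\rho\in\mathcal M_d(\mathbb C)^{\otimes n}$ is separable if it is a finite sum of matrices $\rho^{[1]}\otimes\cdots\otimes\rho^{[n]}$ with all $\rho^{[i]}$ psd. $\|\cdot\|_1$ is the trace norm. Theorem. Let $\Omega$ be a tree on $[n]$. (i) $\underline{\operatorname{nn-rank}}_\Omega(T)=\operatorname{nn-rank}_\Omega(T)$ for every entrywise nonnegative tensor $T\in(\mathbb C^d)^{\otimes n}$. (ii) $\underline{\operatorname{psd-rank}}_\Omega(T)=\operatorname{psd-rank}_\Omega(T)$ for every entrywise nonnegative tensor $T\in(\mathbb C^d)^{\otimes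 n}$. (iii) $\underline{\operatorname{sep-rank}}_\Omega(\rho)=\operatorname{sep-rank}_\Omega(\rho)$ for every separable $\rho\in\mathcal M_d(\mathbb C)^{\otimes n}$. (iv) $\underline{\operatorname{puri-rank}}_\Omega(\rho)=\operatorname{puri-rank}_\Omega(\rho)$ for every psd $\rho\in\mathcal M_d(\mathbb C)^{\otimes n}$. (v) If $\rho\in\mathcal M_d(\mathbb C)^{\otimes n}$ is separable with $\operatorname{sep-rank}_\Omega(\rho)\le r$ and $\|\rho\|_1\le 1$, then $\rho$ has a separable $\Omega$-decomposition of size $r$ in which every local matrix satisfies $\|A^{[i]}_\beta\|_1\le 1$. (vi) If $\rho\in\mathcal M_d(\mathbb C)^{\otimes n}$ is separable with $\operatorname{sep-rank}_\Omega(\rho)\le r$, then for every vertex $v\in[n]$ it has a separable $\Omega$-decomposition of size $r$ with $\operatorname{tr}(A^{[i]}_\beta)\le 1$ for all $i\neq v$ and all $\beta$, and $\sum_{\beta}\operatorname{tr}(A^{[v]}_\beta)=\operatorname{tr}(\rho)$. -/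

import Mathlib

open Filter Topology
open scoped Matrix ComplexOrder

/-- A weighted simplicial complex on the vertex set `Fin n`, all of whose vertices are simplices. -/
structure WSC (n : ℕ) where
  weight : Finset (Fin n) → ℕ
  weight_dvd : ∀ S₁ S₂ : Finset (Fin n), S₁ ⊆ S₂ → weight S₁ ∣ weight S₂
  weight_vertex : ∀ i : Fin n, weight {i} ≠ 0

namespace WSC

variable {n : ℕ}

/-- A facet is an inclusion-maximal simplex, a simplex being a set of nonzero weight. -/
def IsFacet (Ω : WSC n) (F : Finset (Fin n)) : Prop :=
  Maximal (fun S : Finset (Fin n) => Ω.weight S ≠ 0) F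

/-- The multiset of facets: each facet `F` occurs `Ω.weight F` times. -/
abbrev FacetCopy (Ω : WSC n) : Type :=
  (F : {F : Finset (Fin n) // Ω.IsFacet F}) × Fin (Ω.weight F.1)

/-- The (copies of) facets that contain the vertex `i`. -/
abbrev FacetCopyAt (Ω : WSC n) (i : Fin n) : Type :=
  {F : Ω.FacetCopy // i ∈ F.1.1}

noncomputable instance (Ω : WSC n) : DecidablePred Ω.IsFacet := Classical.decPred _

/-- Global summation indices: one value in `Fin r` for each copy of a facet. -/
abbrev GlobalIdx (Ω : WSC n) (r : ℕ) : Type := Ω.FacetCopy → Fin r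

/-- Local indices at the vertex `i`: one value in `Fin r` for each copy of a facet through `i`. -/
abbrev LocalIdx (Ω : WSC n) (r : ℕ) (i : Fin n) : Type := Ω.FacetCopyAt i → Fin r

/-- The restriction of a global index to the facets through `i`. -/
def restrict (Ω : WSC n) {r : ℕ} (α : Ω.GlobalIdx r) (i : Fin n) : Ω.LocalIdx r i :=
  fun F => α F.1

/-- The graph on the vertices whose edges are the two-element facets. -/
def graph (Ω : WSC n) : SimpleGraph (Fin n) where
  Adj i j := i ≠ j ∧ Ω.IsFacet {i, j}
  symm := ⟨fun i j h => ⟨h.1.symm, by rw [Finset.pair_comm]; exact h.2⟩⟩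
  loopless := ⟨fun _ h => h.1 rfl⟩

/-- `Ω` is a tree: a simplicial complex (all weights are `0` or `1`) whose facets have at most two
elements and form a connected graph without cycles. -/
structure IsTree (Ω : WSC n) : Prop where
  weight_le_one : ∀ S, Ω.weight S ≤ 1
  card_facet_le : ∀ F, Ω.IsFacet F → F.card ≤ 2
  graph_isTree : Ω.graph.IsTree

end WSC

/-- Elements of the `n`-fold tensor power of `ℂ^d`, as arrays of entries. -/
abbrev Tensor (n d : ℕ) : Type := (Fin n → Fin d) → ℂ

/-- Elements of the `n`-fold tensor power of the space of `d × d'` matrices. -/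
abbrev MultiMatrix (n d d' : ℕ) : Type := Matrix (Fin n → Fin d) (Fin n → Fin d') ℂ

/-- The elementary tensor `v₁ ⊗ ⋯ ⊗ vₙ`. -/
def elemTensor {n d : ℕ} (v : Fin n → Fin d → ℂ) : Tensor n d :=
  fun j => ∏ i, v i (j i)

/-- The Kronecker product `A₁ ⊗ ⋯ ⊗ Aₙ`. -/
def elemMatrix {n d d' : ℕ} (A : Fin n → Matrix (Fin d) (Fin d') ℂ) : MultiMatrix n d d' :=
  Matrix.of fun j k => ∏ i, A i (j i) (k i)

/-- Separable matrices: finite sums of Kronecker products of psd matrices. -/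
def IsSeparableMatrix {n d : ℕ} (ρ : MultiMatrix n d d) : Prop :=
  ∃ (m : ℕ) (A : Fin m → Fin n → Matrix (Fin d) (Fin d) ℂ),
    (∀ a i, (A a i).PosSemidef) ∧ ρ = ∑ a, elemMatrix (A a)

/-- The trace norm: the sum of the singular values. -/
noncomputable def traceNorm {m : Type*} [Fintype m] [DecidableEq m] (A : Matrix m m ℂ) : ℝ :=
  ∑ i, Real.sqrt ((Matrix.isHermitian_conjTranspose_mul_self A).eigenvalues i)

namespace WSC

variable {n d d' : ℕ}

/-- `A` is an `Ω`-decomposition of the matrix `ρ` with index set `Fin r`. -/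
def IsMatrixDecomp (Ω : WSC n) (r : ℕ)
    (A : ∀ i : Fin n, Ω.LocalIdx r i → Matrix (Fin d) (Fin d') ℂ) (ρ : MultiMatrix n d d') : Prop :=
  ρ = ∑ α : Ω.GlobalIdx r, elemMatrix fun i => A i (Ω.restrict α i)

/-- `A` is a separable `Ω`-decomposition of `ρ` with index set `Fin r`. -/
def IsSepDecomp (Ω : WSC n) (r : ℕ)
    (A : ∀ i : Fin n, Ω.LocalIdx r i → Matrix (Fin d) (Fin d) ℂ) (ρ : MultiMatrix n d d) : Prop :=
  Ω.IsMatrixDecomp r A ρ ∧ ∀ i β, (A i β).PosSemidef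

/-- `T` has a nonnegative `Ω`-decomposition with index set `Fin r`. -/
def HasNNDecomp (Ω : WSC n) (r : ℕ) (T : Tensor n d) : Prop :=
  ∃ v : ∀ i : Fin n, Ω.LocalIdx r i → Fin d → ℂ,
    (∀ i β j, 0 ≤ v i β j) ∧
    T = ∑ α : Ω.GlobalIdx r, elemTensor fun i => v i (Ω.restrict α i)

/-- `T` has a psd `Ω`-decomposition with index set `Fin r`. -/
def HasPsdDecomp (Ω : WSC n) (r : ℕ) (T : Tensor n d) : Prop :=
  ∃ E : ∀ i : Fin n, Fin d → Matrix (Ω.LocalIdx r i) (Ω.LocalIdx r i) ℂ,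
    (∀ i j, (E i j).PosSemidef) ∧
    ∀ j : Fin n → Fin d, T j =
      ∑ α : Ω.GlobalIdx r, ∑ α' : Ω.GlobalIdx r,
        ∏ i, E i (j i) (Ω.restrict α i) (Ω.restrict α' i)

/-- `ρ` has a separable `Ω`-decomposition with index set `Fin r`. -/
def HasSepDecomp (Ω : WSC n) (r : ℕ) (ρ : MultiMatrix n d d) : Prop :=
  ∃ A, Ω.IsSepDecomp r A ρ

/-- `ρ` has an `Ω`-purification with index set `Fin r`: a factorization `ρ = L Lᴴ`, where the local
factors of `L` are `d × d'` matrices for some `d'`, together with an `Ω`-decomposition of `L`. -/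
def HasPurification (Ω : WSC n) (r : ℕ) (ρ : MultiMatrix n d d) : Prop :=
  ∃ (d' : ℕ) (L : MultiMatrix n d d')
    (A : ∀ i : Fin n, Ω.LocalIdx r i → Matrix (Fin d) (Fin d') ℂ),
    ρ = L * Lᴴ ∧ Ω.IsMatrixDecomp r A L

/-- The nonnegative `Ω`-rank (`⊤` if there is no decomposition). -/
noncomputable def nnRank (Ω : WSC n) (T : Tensor n d) : ℕ∞ :=
  ⨅ (r : ℕ) (_ : Ω.HasNNDecomp r T), (r : ℕ∞)

/-- The positive semidefinite `Ω`-rank (`⊤` if there is no decomposition). -/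
noncomputable def psdRank (Ω : WSC n) (T : Tensor n d) : ℕ∞ :=
  ⨅ (r : ℕ) (_ : Ω.HasPsdDecomp r T), (r : ℕ∞)

/-- The separable `Ω`-rank (`⊤` if there is no decomposition). -/
noncomputable def sepRank (Ω : WSC n) (ρ : MultiMatrix n d d) : ℕ∞ :=
  ⨅ (r : ℕ) (_ : Ω.HasSepDecomp r ρ), (r : ℕ∞)

/-- The `Ω`-purification rank (`⊤` if there is no purification). -/
noncomputable def puriRank (Ω : WSC n) (ρ : MultiMatrix n d d) : ℕ∞ :=
  ⨅ (r : ℕ) (_ : Ω.HasPurification r ρ), (r : ℕ∞)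

end WSC

/-- The border rank belonging to a rank function `R`: the least `s` such that `x` is the limit of a
sequence of elements of rank at most `s`. -/
noncomputable def borderRank {X : Type*} [TopologicalSpace X] (R : X → ℕ∞) (x : X) : ℕ∞ :=
  sInf {s : ℕ∞ | ∃ u : ℕ → X, Tendsto u atTop (𝓝 x) ∧ ∀ k, R (u k) ≤ s}

/-! Each border rank identity says that, for every natural number `r`, the set of elements of rank
at most `r` is closed. A limit of decompositions need not exist, because local tensors may blow up
while their contraction stays bounded. On a tree this divergence can be removed by the gauge freedom
on the edges, fixed from the leaves towards a root. Two gauges are used.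

Separable decompositions: psd summands cannot cancel, so only scalar rescaling is needed. For each
value on the parent edge of a vertex, a message towards the root records the total trace of the
branch below. Dividing by it at the child and multiplying by it at the parent leaves the product
unchanged, and the root collects the whole trace (`exists_rescaling`,
`HasSepDecomp.exists_normalized`). This yields the normalization statements. It also bounds all
local entries along a convergent sequence, so compactness gives closedness
(`HasSepDecomp.of_tendsto`). Nonnegative decompositions of a tensor are separable decompositions of
the diagonal matrix it defines.

Purifications: cancellation is now possible, and scalars are replaced by a change of basis on each
edge. Gram-Schmidt makes the tensor at a leaf orthonormal, and the coefficients are absorbed by its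
parent. Orthonormality then bounds the contraction of the remaining tree by the full contraction,
and induction over leaves shows that tree contractions form a closed set
(`IsUpper.exists_net_eq_of_tendsto`). To apply this to `ρ = L * Lᴴ`, Gram factorization makes the
auxiliary dimension uniform, and the diagonal of `ρ` bounds `L`. Psd decompositions are
purifications of diagonal matrices. -/

namespace WSC

variable {n : ℕ}

/-! ### Rooted trees and facets -/

/-- A choice of parents that orients all edges of `Ω` towards the root `v`. -/
structure Rooting (Ω : WSC n) (v : Fin n) where
  par : Fin n → Fin n
  edge : Fin n → Ω.FacetCopy
  depth : Fin n → ℕ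
  depth_par : ∀ u, u ≠ v → depth (par u) < depth u
  mem_edge : ∀ u, u ≠ v → ∀ i, i ∈ (edge u).1.1 ↔ i = u ∨ i = par u
  eq_edge : ∀ (F : Ω.FacetCopy) (i u : Fin n), i ∈ F.1.1 → u ∈ F.1.1 → i ≠ u →
    (u ≠ v ∧ F = edge u ∧ i = par u) ∨ (i ≠ v ∧ F = edge i ∧ u = par i)

lemma exists_isFacet_mem (Ω : WSC n) (i : Fin n) : ∃ F, Ω.IsFacet F ∧ i ∈ F := by
  obtain ⟨F, hF, hm⟩ := (Set.toFinite {S : Finset (Fin n) | Ω.weight S ≠ 0}).exists_le_maximal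
    (Ω.weight_vertex i)
  exact ⟨F, hm, hF (by simp)⟩

lemma IsFacet.weight_ne_zero {Ω : WSC n} {F : Finset (Fin n)} (h : Ω.IsFacet F) :
    Ω.weight F ≠ 0 := h.prop

lemma exists_facetCopy_mem (Ω : WSC n) (i : Fin n) : ∃ F : Ω.FacetCopy, i ∈ F.1.1 := by
  obtain ⟨F, hF, hi⟩ := Ω.exists_isFacet_mem i
  exact ⟨⟨⟨F, hF⟩, ⟨0, Nat.pos_of_ne_zero hF.weight_ne_zero⟩⟩, hi⟩

lemma IsFacet.nonempty {Ω : WSC n} {F : Finset (Fin n)} (h : Ω.IsFacet F) (v : Fin n) :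
    F.Nonempty := by
  by_contra hF
  rw [Finset.not_nonempty_iff_eq_empty] at hF
  subst hF
  have := h.le_of_ge (Ω.weight_vertex v) (by simp)
  simpa using this (Finset.mem_singleton_self v)

lemma IsTree.facetCopy_ext {Ω : WSC n} (hΩ : Ω.IsTree) {F G : Ω.FacetCopy} (h : F.1.1 = G.1.1) :
    F = G := by
  obtain ⟨⟨F, hF⟩, a⟩ := F
  obtain ⟨⟨G, hG⟩, b⟩ := G
  obtain rfl : F = G := h
  have : Subsingleton (Fin (Ω.weight F)) := Fin.subsingleton_iff_le_one.2 (hΩ.weight_le_one F)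
  rw [Subsingleton.elim a b]

lemma IsTree.facet_eq_pair {Ω : WSC n} (hΩ : Ω.IsTree) {F : Finset (Fin n)} (hF : Ω.IsFacet F)
    {i u : Fin n} (hi : i ∈ F) (hu : u ∈ F) (hne : i ≠ u) : F = {i, u} := by
  symm
  apply Finset.eq_of_subset_of_card_le
  · intro x hx
    simp only [Finset.mem_insert, Finset.mem_singleton] at hx
    rcases hx with rfl | rfl <;> assumption
  · rw [Finset.card_pair hne]
    exact hΩ.card_facet_le F hF

/-- The next vertex on the way from a vertex of a tree to the root. -/
lemma _root_.SimpleGraph.IsTree.exists_parent {V : Type*} {G : SimpleGraph V} (hG : G.IsTree)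
    (v u : V) (hu : u ≠ v) : ∃ w, G.Adj u w ∧ G.dist w v < G.dist u v ∧
      ∀ i, G.Adj u i → G.dist i v < G.dist u v → i = w := by
  obtain ⟨p, hp, hlen⟩ := hG.connected.exists_path_of_dist u v
  have hnil : ¬ p.Nil := SimpleGraph.Walk.not_nil_of_ne hu
  have hadj := p.adj_snd hnil
  have htail : p.tail.length + 1 = p.length := SimpleGraph.Walk.length_tail_add_one hnil
  refine ⟨p.snd, hadj, ?_, ?_⟩
  · have := SimpleGraph.dist_le p.tail
    omega
  · intro i hi hd
    obtain ⟨q, hq, hql⟩ := hG.connected.exists_path_of_dist i v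
    have h1 : G.dist u v ≤ (SimpleGraph.Walk.cons hi q).length := SimpleGraph.dist_le _
    rw [SimpleGraph.Walk.length_cons] at h1
    have h2 : (SimpleGraph.Walk.cons hi q).IsPath := by
      apply SimpleGraph.Walk.isPath_of_length_eq_dist
      rw [SimpleGraph.Walk.length_cons]
      omega
    have := (hG.existsUnique_path u v).unique hp h2
    rw [this]
    simp

/-- Depth is the graph distance to `v`. Adjacent vertices of a tree have different distances to `v`,
and the nearer end of an edge is the parent of the other. -/
lemma IsTree.exists_rooting {Ω : WSC n} (hΩ : Ω.IsTree) (v : Fin n) : Nonempty (Ω.Rooting v) := by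
  classical
  have key : ∀ u : Fin n, ∃ w : Fin n, ∃ F : Ω.FacetCopy, u ≠ v →
      Ω.graph.Adj u w ∧ F.1.1 = {u, w} ∧ Ω.graph.dist w v < Ω.graph.dist u v ∧
      ∀ i, Ω.graph.Adj u i → Ω.graph.dist i v < Ω.graph.dist u v → i = w := by
    intro u
    by_cases hu : u = v
    -- The root has no parent; these values are placeholders.
    · obtain ⟨F, -⟩ := Ω.exists_facetCopy_mem u
      exact ⟨u, F, fun h => absurd hu h⟩
    · obtain ⟨w, hw, hd, huniq⟩ := hΩ.graph_isTree.exists_parent v u hu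
      exact ⟨w, ⟨⟨_, hw.2⟩, ⟨0, Nat.pos_of_ne_zero (hw.2).weight_ne_zero⟩⟩,
        fun _ => ⟨hw, rfl, hd, huniq⟩⟩
  choose par edge h using key
  have key2 : ∀ (F : Ω.FacetCopy) (i u : Fin n), i ∈ F.1.1 → u ∈ F.1.1 → i ≠ u →
      Ω.graph.dist i v < Ω.graph.dist u v → (u ≠ v ∧ F = edge u ∧ i = par u) := by
    intro F i u hi hu hne hd
    have hF := hΩ.facet_eq_pair F.1.2 hu hi hne.symm
    have hadj : Ω.graph.Adj u i := ⟨hne.symm, hF ▸ F.1.2⟩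
    have huv : u ≠ v := by
      rintro rfl
      simp at hd
    obtain ⟨h1, h2, h3, h4⟩ := h u huv
    have := h4 i hadj hd
    subst this
    exact ⟨huv, hΩ.facetCopy_ext (hF.trans h2.symm), rfl⟩
  refine ⟨⟨par, edge, fun u => Ω.graph.dist u v, fun u hu => (h u hu).2.2.1, ?_, ?_⟩⟩
  · intro u hu i
    rw [(h u hu).2.1]
    simp
  · intro F i u hi hu hne
    have hF := hΩ.facet_eq_pair F.1.2 hu hi hne.symm
    have hadj : Ω.graph.Adj u i := ⟨hne.symm, hF ▸ F.1.2⟩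
    have := hΩ.graph_isTree.dist_ne_of_adj v hadj
    rw [SimpleGraph.dist_comm, SimpleGraph.dist_comm (u := v)] at this
    rcases lt_or_gt_of_ne this with hlt | hlt
    · exact Or.inr (key2 F u i hu hi hne.symm hlt)
    · exact Or.inl (key2 F i u hi hu hne hlt)

/-- With at least two vertices, connectedness rules out one-element facets, since a lone vertex
would lie in a strictly larger facet. So every facet is an edge, and its deeper end owns it. -/
lemma IsTree.exists_edge_eq {Ω : WSC n} (hΩ : Ω.IsTree) {v : Fin n} (R : Ω.Rooting v)
    (hn : Nontrivial (Fin n)) (F : Ω.FacetCopy) : ∃ u, u ≠ v ∧ R.edge u = F := by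
  obtain ⟨i, hi⟩ := F.1.2.nonempty v
  have : ∃ j ∈ F.1.1, j ≠ i := by
    obtain ⟨w, hw⟩ := hΩ.graph_isTree.connected.preconnected.exists_adj_of_nontrivial i
    by_contra hcon
    push Not at hcon
    have hsub : F.1.1 ≤ {i, w} := by
      intro x hx
      simp [hcon x hx]
    have := F.1.2.le_of_ge hw.2.weight_ne_zero hsub
    exact hw.1 (hcon w (this (by simp))).symm
  obtain ⟨j, hj, hji⟩ := this
  rcases R.eq_edge F j i hj hi hji with ⟨h1, h2, -⟩ | ⟨h1, h2, -⟩
  · exact ⟨i, h1, h2.symm⟩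
  · exact ⟨j, h1, h2.symm⟩

namespace Rooting

variable {Ω : WSC n} {v : Fin n} (R : Ω.Rooting v)

lemma mem_edge_self {u : Fin n} (hu : u ≠ v) : u ∈ (R.edge u).1.1 :=
  (R.mem_edge u hu u).2 (Or.inl rfl)

lemma par_mem_edge {u : Fin n} (hu : u ≠ v) : R.par u ∈ (R.edge u).1.1 :=
  (R.mem_edge u hu _).2 (Or.inr rfl)

lemma par_ne {u : Fin n} (hu : u ≠ v) : R.par u ≠ u := by
  intro h
  have := R.depth_par u hu
  rw [h] at this
  exact lt_irrefl _ this

/-- Two distinct vertices sharing a parent edge would be parents of each other, contradicting the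
decrease of depth. -/
lemma edge_injective {u w : Fin n} (hu : u ≠ v) (hw : w ≠ v) (h : R.edge u = R.edge w) : u = w := by
  by_contra hne
  have h1 := (R.mem_edge w hw u).1 (h ▸ R.mem_edge_self hu)
  have h2 := (R.mem_edge u hu w).1 (h ▸ R.mem_edge_self hw)
  have h1 := h1.resolve_left hne
  have h2 := h2.resolve_left (Ne.symm hne)
  have h3 := R.depth_par u hu
  have h4 := R.depth_par w hw
  rw [← h2] at h3
  rw [← h1] at h4
  omega

end Rooting

end WSC

/-! ### Messages and the rescaling of nonnegative weights -/

namespace WSC.Rooting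

variable {n r : ℕ} {Ω : WSC n} {v : Fin n} (R : Ω.Rooting v)

/-- The total weight of the local indices at `u` with value `a` on the parent edge, where `μ` gives
the weights of the remaining edges. -/
noncomputable def upSum (t : ∀ i, Ω.LocalIdx r i → ℝ) (μ : Ω.FacetCopy → Fin r → ℝ) (u : Fin n)
    (a : Fin r) : ℝ :=
  ∑ β : Ω.LocalIdx r u with ∀ F : Ω.FacetCopyAt u, F.1 = R.edge u → β F = a,
    t u β * ∏ F : Ω.FacetCopyAt u, if F.1 = R.edge u then 1 else μ F.1 (β F)

/-- Messages sent from the leaves to the root. -/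
lemma exists_messages (t : ∀ i, Ω.LocalIdx r i → ℝ) (ht : ∀ i β, 0 ≤ t i β) :
    ∃ μ : Ω.FacetCopy → Fin r → ℝ, (∀ F a, 0 ≤ μ F a) ∧
      (∀ F, (∀ u, u ≠ v → F ≠ R.edge u) → ∀ a, μ F a = 1) ∧
      ∀ u, u ≠ v → ∀ a, μ (R.edge u) a = R.upSum t μ u a := by
  classical
  set D := Finset.univ.sup R.depth with hD
  have hdepth : ∀ u, R.depth u ≤ D := fun u => Finset.le_sup (Finset.mem_univ u)
  -- Induction on layers, deepest first: after `k` rounds the recursion holds at every vertex of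
  -- depth greater than `D - k`.
  have key : ∀ k : ℕ, ∃ μ : Ω.FacetCopy → Fin r → ℝ, (∀ F a, 0 ≤ μ F a) ∧
      (∀ F, (∀ u, u ≠ v → F ≠ R.edge u) → ∀ a, μ F a = 1) ∧
      ∀ u, u ≠ v → D < R.depth u + k → ∀ a, μ (R.edge u) a = R.upSum t μ u a := by
    intro k
    induction k with
    | zero =>
      refine ⟨fun _ _ => 1, fun _ _ => zero_le_one, fun _ _ _ => rfl, fun u _ h => ?_⟩
      have := hdepth u
      omega
    | succ k ih =>
      obtain ⟨μ, h0, h1, h2⟩ := ih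
      set μ' : Ω.FacetCopy → Fin r → ℝ := fun F a =>
        if h : ∃ u, u ≠ v ∧ F = R.edge u ∧ R.depth u + k = D then R.upSum t μ h.choose a
        else μ F a with hμ'
      have hedge : ∀ u, u ≠ v → R.depth u + k = D → ∀ a, μ' (R.edge u) a = R.upSum t μ u a := by
        intro u hu hk a
        have h : ∃ w, w ≠ v ∧ R.edge u = R.edge w ∧ R.depth w + k = D := ⟨u, hu, rfl, hk⟩
        simp only [hμ', dif_pos h]
        rw [← R.edge_injective hu h.choose_spec.1 h.choose_spec.2.1]
      have hold : ∀ F, (¬ ∃ u, u ≠ v ∧ F = R.edge u ∧ R.depth u + k = D) → μ' F = μ F := by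
        intro F h
        funext a
        simp only [hμ', dif_neg h]
      -- The messages entering the sum at `u` come from its children, which are strictly deeper than
      -- the layer being changed.
      have hsum : ∀ u, u ≠ v → D ≤ R.depth u + k → ∀ a, R.upSum t μ' u a = R.upSum t μ u a := by
        intro u hu hk a
        unfold upSum
        refine Finset.sum_congr rfl fun β _ => ?_
        congr 1
        refine Finset.prod_congr rfl fun F _ => ?_
        split_ifs with hF
        · rfl
        · rw [hold]
          rintro ⟨w, hw, hFw, hdw⟩
          have hmem := F.2
          rw [hFw] at hmem
          rcases (R.mem_edge w hw u).1 hmem with rfl | h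
          · exact hF hFw
          · have := R.depth_par w hw
            rw [← h] at this
            omega
      refine ⟨μ', ?_, ?_, ?_⟩
      · intro F a
        simp only [hμ']
        split_ifs with h
        · unfold upSum
          refine Finset.sum_nonneg fun β _ => mul_nonneg (ht _ _) (Finset.prod_nonneg fun F _ => ?_)
          split_ifs
          · exact zero_le_one
          · exact h0 _ _
        · exact h0 _ _
      · intro F hF a
        rw [hold]
        · exact h1 F hF a
        · rintro ⟨u, hu, h, -⟩
          exact hF u hu h
      · intro u hu hk a
        rw [hsum u hu (by omega)]
        by_cases h : R.depth u + k = D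
        · exact hedge u hu h a
        · rw [hold]
          · exact h2 u hu (by omega) a
          · rintro ⟨w, hw, h3, h4⟩
            rw [R.edge_injective hu hw h3] at h
            exact h h4
  obtain ⟨μ, h0, h1, h2⟩ := key (D + 1)
  exact ⟨μ, h0, h1, fun u hu => h2 u hu (by omega)⟩

/-- The factor by which the messages rescale the local weight at the vertex `i`. -/
noncomputable def rescale (μ : Ω.FacetCopy → Fin r → ℝ) (i : Fin n) (β : Ω.LocalIdx r i) : ℝ :=
  ∏ F : Ω.FacetCopyAt i,
    if i ≠ v ∧ F.1 = R.edge i then (μ F.1 (β F))⁻¹ else μ F.1 (β F)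

lemma rescale_nonneg {μ : Ω.FacetCopy → Fin r → ℝ} (h0 : ∀ F a, 0 ≤ μ F a) (i : Fin n)
    (β : Ω.LocalIdx r i) : 0 ≤ R.rescale μ i β := by
  unfold rescale
  refine Finset.prod_nonneg fun F _ => ?_
  split_ifs
  · exact inv_nonneg.2 (h0 _ _)
  · exact h0 _ _

/-- Each edge contributes the inverse message at the child and the message at the parent, and these
cancel. Facets that are no parent edge carry the value one. -/
lemma prod_rescale {μ : Ω.FacetCopy → Fin r → ℝ}
    (h1 : ∀ F, (∀ u, u ≠ v → F ≠ R.edge u) → ∀ a, μ F a = 1) (α : Ω.GlobalIdx r)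
    (hα : ∀ F, μ F (α F) ≠ 0) : ∏ i, R.rescale μ i (Ω.restrict α i) = 1 := by
  classical
  have hi : ∀ i, R.rescale μ i (Ω.restrict α i) = ∏ F : Ω.FacetCopy, if i ∈ F.1.1 then
      (if i ≠ v ∧ F = R.edge i then (μ F (α F))⁻¹ else μ F (α F)) else 1 := by
    intro i
    unfold rescale restrict
    rw [← Finset.prod_filter, ← Finset.prod_subtype_eq_prod_filter]
    refine Finset.prod_bij (fun F _ => F) ?_ ?_ ?_ ?_ <;> simp
  simp_rw [hi]
  rw [Finset.prod_comm]
  refine Finset.prod_eq_one fun F _ => ?_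
  by_cases hF : ∃ u, u ≠ v ∧ F = R.edge u
  · obtain ⟨u, hu, rfl⟩ := hF
    rw [Finset.prod_eq_mul u (R.par u) (R.par_ne hu).symm]
    · have : ¬ (R.par u ≠ v ∧ R.edge u = R.edge (R.par u)) := fun h =>
        R.par_ne hu (R.edge_injective hu h.1 h.2).symm
      rw [if_pos (R.mem_edge_self hu), if_pos (R.par_mem_edge hu), if_pos ⟨hu, rfl⟩, if_neg this,
        inv_mul_cancel₀ (hα _)]
    · intro i _ hne
      rw [if_neg]
      intro h
      rcases (R.mem_edge u hu i).1 h with h | h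
      · exact hne.1 h
      · exact hne.2 h
    · simp
    · simp
  · push Not at hF
    refine Finset.prod_eq_one fun i _ => ?_
    simp [h1 F hF]

/-- This makes zero messages harmless. At the deepest vertex whose message vanishes along `α`, the
incoming messages are nonzero, so a vanishing sum of nonnegative terms forces the local weight
itself to vanish. -/
lemma exists_weight_eq_zero {t : ∀ i, Ω.LocalIdx r i → ℝ} (ht : ∀ i β, 0 ≤ t i β)
    {μ : Ω.FacetCopy → Fin r → ℝ} (h0 : ∀ F a, 0 ≤ μ F a)
    (h1 : ∀ F, (∀ u, u ≠ v → F ≠ R.edge u) → ∀ a, μ F a = 1)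
    (h2 : ∀ u, u ≠ v → ∀ a, μ (R.edge u) a = R.upSum t μ u a) (α : Ω.GlobalIdx r)
    (hα : ∃ F, μ F (α F) = 0) : ∃ i, t i (Ω.restrict α i) = 0 := by
  classical
  have hex : ∀ F, μ F (α F) = 0 → ∃ u, u ≠ v ∧ F = R.edge u := by
    intro F hF
    by_contra hcon
    push Not at hcon
    rw [h1 F hcon] at hF
    exact one_ne_zero hF
  obtain ⟨F, hF⟩ := hα
  obtain ⟨u₀, hu₀, rfl⟩ := hex F hF
  obtain ⟨u, hu, hmax⟩ := Finset.exists_max_image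
    (Finset.univ.filter fun u => u ≠ v ∧ μ (R.edge u) (α (R.edge u)) = 0) R.depth
    ⟨u₀, by simp [hu₀, hF]⟩
  simp only [Finset.mem_filter, Finset.mem_univ, true_and] at hu hmax
  refine ⟨u, ?_⟩
  have h := h2 u hu.1 (α (R.edge u))
  rw [hu.2, upSum, eq_comm, Finset.sum_eq_zero_iff_of_nonneg] at h
  · have := h (Ω.restrict α u) (by
      simp only [Finset.mem_filter, Finset.mem_univ, true_and]
      intro F hF
      rw [← hF]
      rfl)
    refine (mul_eq_zero.1 this).resolve_right ?_
    refine Finset.prod_ne_zero_iff.2 fun F _ => ?_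
    split_ifs with hF
    · exact one_ne_zero
    · intro hz
      obtain ⟨w, hw, hFw⟩ := hex F.1 hz
      have hm := F.2
      rw [hFw] at hm hz
      have hz' : μ (R.edge w) (α (R.edge w)) = 0 := by
        rw [← hz, restrict, hFw]
      have := hmax w ⟨hw, hz'⟩
      rcases (R.mem_edge w hw u).1 hm with rfl | h
      · exact hF hFw
      · have := R.depth_par w hw
        rw [← h] at this
        omega
  · intro β _
    refine mul_nonneg (ht _ _) (Finset.prod_nonneg fun F _ => ?_)
    split_ifs
    · exact zero_le_one
    · exact h0 _ _

/-- The right-hand side stays a product because it is one for a nonzero message but zero for a zero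
message, with `0⁻¹ = 0`. -/
lemma sum_rescale_mul {t : ∀ i, Ω.LocalIdx r i → ℝ} {μ : Ω.FacetCopy → Fin r → ℝ}
    (h2 : ∀ u, u ≠ v → ∀ a, μ (R.edge u) a = R.upSum t μ u a) {u : Fin n} (hu : u ≠ v)
    (a : Fin r) :
    ∑ β : Ω.LocalIdx r u with ∀ F : Ω.FacetCopyAt u, F.1 = R.edge u → β F = a,
      R.rescale μ u β * t u β = (μ (R.edge u) a)⁻¹ * μ (R.edge u) a := by
  classical
  -- Naming the inverse keeps the next rewrite from unfolding the message inside it.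
  generalize hm : (μ (R.edge u) a)⁻¹ = m
  rw [h2 u hu a, upSum, Finset.mul_sum]
  refine Finset.sum_congr rfl fun β hβ => ?_
  simp only [Finset.mem_filter, Finset.mem_univ, true_and] at hβ
  rw [← mul_assoc, mul_right_comm]
  congr 1
  unfold rescale
  rw [← Finset.mul_prod_erase _ _ (Finset.mem_univ (⟨R.edge u, R.mem_edge_self hu⟩ :
      Ω.FacetCopyAt u)),
    ← Finset.mul_prod_erase Finset.univ (fun F : Ω.FacetCopyAt u =>
      if F.1 = R.edge u then (1 : ℝ) else μ F.1 (β F)) (Finset.mem_univ (⟨R.edge u,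
        R.mem_edge_self hu⟩ : Ω.FacetCopyAt u))]
  rw [if_pos ⟨hu, rfl⟩, if_pos rfl, one_mul, hβ _ rfl, hm]
  congr 1
  refine Finset.prod_congr rfl fun F hF => ?_
  have : F.1 ≠ R.edge u := fun h => (Finset.mem_erase.1 hF).1 (Subtype.ext h)
  simp [this]

/-- Summing out the vertices from the leaves to the root, for weights that are normalized at all
vertices except the root. -/
lemma sum_prod_eq_sum_root (s : ∀ i, Ω.LocalIdx r i → ℝ) (α₀ : Ω.GlobalIdx r)
    (hs : ∀ u, u ≠ v → ∀ a : Fin r,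
      (∑ β : Ω.LocalIdx r u with ∀ F : Ω.FacetCopyAt u, F.1 = R.edge u → β F = a, s u β = 1) ∨
      ∀ α : Ω.GlobalIdx r, α (R.edge u) = a → s (R.par u) (Ω.restrict α (R.par u)) = 0)
    (I : Finset (Fin n)) (hv : v ∉ I) (hI : ∀ u ∈ I, R.par u ∈ insert v I) :
    ∑ α : Ω.GlobalIdx r with ∀ F : Ω.FacetCopy, (∀ i ∈ insert v I, i ∉ F.1.1) → α F = α₀ F,
      ∏ i ∈ insert v I, s i (Ω.restrict α i) =
    ∑ α : Ω.GlobalIdx r with ∀ F : Ω.FacetCopy, v ∉ F.1.1 → α F = α₀ F,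
      s v (Ω.restrict α v) := by
  classical
  induction hk : I.card generalizing I with
  | zero =>
    rw [Finset.card_eq_zero] at hk
    subst hk
    simp
  | succ k ih =>
    have hne : I.Nonempty := by
      rw [← Finset.card_pos]
      omega
    obtain ⟨u, huI, hmax⟩ := Finset.exists_max_image I R.depth hne
    have huv : u ≠ v := fun h => hv (h ▸ huI)
    set J := I.erase u with hJ
    have hIJ : I = insert u J := (Finset.insert_erase huI).symm
    have huJ : u ∉ insert v J := by simp [hJ, huv]
    have hparJ : ∀ w ∈ I, R.par w ∈ insert v J := by
      intro w hw
      have h1 := hI w hw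
      rw [Finset.mem_insert] at h1 ⊢
      refine h1.imp_right fun h => Finset.mem_erase.2 ⟨?_, h⟩
      intro h'
      have h2 := R.depth_par w (fun h => hv (h ▸ hw))
      have h3 := hmax w hw
      rw [h'] at h2
      omega
    have hvJ : v ∉ J := fun h => hv (Finset.mem_of_mem_erase h)
    rw [← ih J hvJ (fun w hw => hparJ w (Finset.mem_of_mem_erase hw))
      (by rw [hJ, Finset.card_erase_of_mem huI, hk]; rfl)]
    have huniq : ∀ F : Ω.FacetCopy, u ∈ F.1.1 → ∀ i ∈ insert v J, i ∈ F.1.1 → F = R.edge u := by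
      intro F huF i hi hiF
      have hiu : i ≠ u := fun h => huJ (h ▸ hi)
      rcases R.eq_edge F i u hiF huF hiu with h | h
      · exact h.2.1
      · exfalso
        have hiI : i ∈ I := Finset.mem_of_mem_erase ((Finset.mem_insert.1 hi).resolve_left h.1)
        have := hparJ i hiI
        rw [← h.2.2] at this
        exact huJ this
    have hins : insert v I = insert u (insert v J) := by
      rw [hIJ, Finset.insert_comm]
    -- Forgetting the facets that do not meet the smaller tree, by resetting them to `α₀`. A fibre
    -- of `z` is parametrized by the local indices at `u` with prescribed value on the parent edge.
    set z : Ω.GlobalIdx r → Ω.GlobalIdx r := fun α F =>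
      if ∀ i ∈ insert v J, i ∉ F.1.1 then α₀ F else α F with hz
    have hzr : ∀ α, ∀ i ∈ insert v J, Ω.restrict (z α) i = Ω.restrict α i := by
      intro α i hi
      funext F
      have : ¬ ∀ i ∈ insert v J, i ∉ F.1.1.1 := fun h => h i hi F.2
      simp only [restrict, hz, if_neg this]
    rw [← Finset.sum_fiberwise_of_maps_to (g := z)
      (t := Finset.univ.filter fun α : Ω.GlobalIdx r =>
        ∀ F : Ω.FacetCopy, (∀ i ∈ insert v J, i ∉ F.1.1) → α F = α₀ F)]
    swap
    · intro α _
      simp only [Finset.mem_filter, Finset.mem_univ, true_and]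
      intro F hF
      simp only [hz, if_pos hF]
    refine Finset.sum_congr rfl fun α hα => ?_
    simp only [Finset.mem_filter, Finset.mem_univ, true_and] at hα
    have hfac : ∀ α' ∈ (Finset.univ.filter fun α : Ω.GlobalIdx r =>
          ∀ F : Ω.FacetCopy, (∀ i ∈ insert v I, i ∉ F.1.1) → α F = α₀ F).filter
            (fun α' => z α' = α),
        ∏ i ∈ insert v I, s i (Ω.restrict α' i) =
          s u (Ω.restrict α' u) * ∏ i ∈ insert v J, s i (Ω.restrict α i) := by
      intro α' hα'
      rw [hins, Finset.prod_insert huJ]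
      congr 1
      refine Finset.prod_congr rfl fun i hi => ?_
      rw [← (Finset.mem_filter.1 hα').2, hzr _ i hi]
    rw [Finset.sum_congr rfl hfac, ← Finset.sum_mul]
    rcases hs u huv (α (R.edge u)) with h | h
    · convert one_mul _
      rw [← h]
      refine Finset.sum_bij' (fun α' _ => Ω.restrict α' u)
        (fun β _ F => if h : u ∈ F.1.1 then β ⟨F, h⟩ else α F) ?_ ?_ ?_ ?_ ?_
      · intro α' hα'
        simp only [Finset.mem_filter, Finset.mem_univ, true_and] at hα' ⊢
        intro F hF
        have : ¬ ∀ i ∈ insert v J, i ∉ (R.edge u).1.1 := fun h =>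
          h _ (hparJ u huI) (R.par_mem_edge huv)
        rw [← hα'.2]
        simp only [hz, if_neg this, restrict, hF]
      · intro β hβ
        simp only [Finset.mem_filter, Finset.mem_univ, true_and] at hβ ⊢
        constructor
        · intro F hF
          rw [hins] at hF
          rw [dif_neg (hF u (Finset.mem_insert_self _ _))]
          exact hα F fun i hi => hF i (Finset.mem_insert_of_mem hi)
        · funext F
          simp only [hz]
          split_ifs with h1 h2
          · exact (hα F h1).symm
          · push Not at h1
            obtain ⟨i, hi, hiF⟩ := h1
            have := huniq F h2 i hi hiF
            rw [hβ ⟨F, h2⟩ this, this]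
          · rfl
      · intro α' hα'
        simp only [Finset.mem_filter, Finset.mem_univ, true_and] at hα'
        funext F
        split_ifs with h1
        · rfl
        · rw [← hα'.2]
          simp only [hz]
          split_ifs with h2
          · refine (hα'.1 F ?_).symm
            rw [hins]
            intro i hi
            rcases Finset.mem_insert.1 hi with rfl | hi
            · exact h1
            · exact h2 i hi
          · rfl
      · intro β hβ
        funext F
        simp [restrict, F.2]
      · intro α' _
        rfl
    -- If the sum at `u` is not normalized, the weight at its parent vanishes and both sides are
    -- zero.
    · rw [Finset.prod_eq_zero (hparJ u huI) (h α rfl), mul_zero]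

lemma exists_rescaling (R : Ω.Rooting v) (t : ∀ i, Ω.LocalIdx r i → ℝ) (ht : ∀ i β, 0 ≤ t i β) :
    ∃ c : ∀ i, Ω.LocalIdx r i → ℝ, (∀ i β, 0 ≤ c i β) ∧
      (∀ α : Ω.GlobalIdx r, ∏ i, c i (Ω.restrict α i) = 1 ∨ ∃ i, t i (Ω.restrict α i) = 0) ∧
      (∀ u, u ≠ v → ∀ β, c u β * t u β ≤ 1) ∧
      ∑ β, c v β * t v β = ∑ α : Ω.GlobalIdx r, ∏ i, t i (Ω.restrict α i) := by
  classical
  obtain ⟨μ, h0, h1, h2⟩ := R.exists_messages t ht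
  have hprod : ∀ α : Ω.GlobalIdx r,
      ∏ i, R.rescale μ i (Ω.restrict α i) = 1 ∨ ∃ i, t i (Ω.restrict α i) = 0 := by
    intro α
    by_cases h : ∃ F, μ F (α F) = 0
    · exact Or.inr (R.exists_weight_eq_zero ht h0 h1 h2 α h)
    · push Not at h
      exact Or.inl (R.prod_rescale h1 α h)
  refine ⟨R.rescale μ, R.rescale_nonneg h0, hprod, ?_, ?_⟩
  · intro u hu β
    have h := R.sum_rescale_mul h2 hu (β ⟨R.edge u, R.mem_edge_self hu⟩)
    refine le_trans (Finset.single_le_sum (f := fun β => R.rescale μ u β * t u β)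
      (fun β _ => mul_nonneg (R.rescale_nonneg h0 _ _) (ht _ _)) ?_) (h.trans_le ?_)
    · simp only [Finset.mem_filter, Finset.mem_univ, true_and]
      rintro ⟨F, hF⟩ rfl
      rfl
    · exact inv_mul_le_one
  · obtain ⟨F₀, hF₀⟩ := Ω.exists_facetCopy_mem v
    -- For `r = 0` there is no default index, but both sums are empty, because the root lies on some
    -- facet.
    rcases isEmpty_or_nonempty (Fin r) with hr | ⟨⟨a₀⟩⟩
    · have : IsEmpty (Ω.LocalIdx r v) := ⟨fun β => hr.elim (β ⟨F₀, hF₀⟩)⟩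
      have : IsEmpty (Ω.GlobalIdx r) := ⟨fun α => hr.elim (α F₀)⟩
      simp
    set s : ∀ i, Ω.LocalIdx r i → ℝ := fun i β => R.rescale μ i β * t i β with hs
    -- A zero message also appears as a factor at the parent; this gives the second alternative.
    have hroot := R.sum_prod_eq_sum_root s (fun _ => a₀) (by
      intro u hu a
      by_cases ha : μ (R.edge u) a = 0
      · right
        intro α hα
        simp only [hs]
        refine mul_eq_zero_of_left ?_ _
        refine Finset.prod_eq_zero (Finset.mem_univ ⟨R.edge u, R.par_mem_edge hu⟩) ?_
        rw [if_neg]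
        · simp only [restrict, hα, ha]
        · exact fun h => R.par_ne hu (R.edge_injective hu h.1 h.2).symm
      · left
        simp only [hs]
        rw [R.sum_rescale_mul h2 hu a, inv_mul_cancel₀ ha])
      (Finset.univ.erase v) (by simp) (by
        intro u _
        simp)
    rw [Finset.insert_erase (Finset.mem_univ v)] at hroot
    have hall : (Finset.univ.filter fun α : Ω.GlobalIdx r =>
        ∀ F : Ω.FacetCopy, (∀ i ∈ Finset.univ, i ∉ F.1.1) → α F = a₀) = Finset.univ := by
      rw [Finset.filter_true_of_mem]
      intro α _ F hF
      obtain ⟨i, hi⟩ := F.1.2.nonempty v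
      exact absurd hi (hF i (Finset.mem_univ i))
    rw [hall] at hroot
    calc ∑ β, R.rescale μ v β * t v β
        = ∑ α : Ω.GlobalIdx r with ∀ F : Ω.FacetCopy, v ∉ F.1.1 → α F = a₀,
            s v (Ω.restrict α v) := by
          symm
          refine Finset.sum_bij' (fun α _ => Ω.restrict α v)
            (fun β _ F => if h : v ∈ F.1.1 then β ⟨F, h⟩ else a₀) ?_ ?_ ?_ ?_ ?_
          · simp
          · intro β _
            simp only [Finset.mem_filter, Finset.mem_univ, true_and]
            intro F hF
            rw [dif_neg hF]
          · intro α hα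
            simp only [Finset.mem_filter, Finset.mem_univ, true_and] at hα
            funext F
            split_ifs with h
            · rfl
            · exact (hα F h).symm
          · intro β _
            funext F
            simp [restrict, F.2]
          · intro α _
            rfl
      _ = ∑ α : Ω.GlobalIdx r, ∏ i, s i (Ω.restrict α i) := hroot.symm
      _ = _ := by
          refine Finset.sum_congr rfl fun α _ => ?_
          simp only [hs]
          rw [Finset.prod_mul_distrib]
          rcases hprod α with h | ⟨i, h⟩
          · rw [h, one_mul]
          · rw [Finset.prod_eq_zero (f := fun i => t i (Ω.restrict α i)) (Finset.mem_univ i) h,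
              mul_zero]

end WSC.Rooting

/-! ### Psd matrices, trace norm and Kronecker products -/

/-- A two-by-two principal minor is nonnegative, so the squared modulus of an entry is at most the
product of two diagonal entries. This turns trace bounds into compactness. -/
lemma Matrix.PosSemidef.norm_apply_le_trace {m : Type*} [Fintype m] {A : Matrix m m ℂ}
    (hA : A.PosSemidef) (i j : m) : ‖A i j‖ ≤ A.trace.re := by
  have hdiag : ∀ k, 0 ≤ (A k k).re ∧ (A k k).im = 0 := fun k => by
    have := hA.diag_nonneg (i := k)
    rw [Complex.nonneg_iff] at this
    exact ⟨this.1, this.2.symm⟩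
  have hle : ∀ k, (A k k).re ≤ A.trace.re := by
    intro k
    rw [Matrix.trace, Complex.re_sum]
    exact Finset.single_le_sum (f := fun k => (A.diag k).re) (fun k _ => (hdiag k).1)
      (Finset.mem_univ k)
  have hdet := (hA.submatrix ![i, j]).det_nonneg
  rw [Matrix.det_fin_two] at hdet
  simp only [Matrix.submatrix_apply, Matrix.cons_val_zero, Matrix.cons_val_one] at hdet
  have hji : A j i = star (A i j) := (hA.1.apply j i).symm
  rw [hji, Complex.nonneg_iff] at hdet
  have h1 := hdet.1
  simp only [Complex.sub_re, Complex.mul_re, Complex.star_def, Complex.conj_re, Complex.conj_im,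
    (hdiag i).2, (hdiag j).2] at h1
  have hsq : ‖A i j‖ ^ 2 = (A i j).re * (A i j).re + (A i j).im * (A i j).im := by
    rw [← Complex.normSq_eq_norm_sq, Complex.normSq_apply]
  refine le_of_sq_le_sq ?_ ((hdiag i).1.trans (hle i))
  have := mul_le_mul (hle i) (hle j) (hdiag j).1 ((hdiag i).1.trans (hle i))
  nlinarith

lemma traceNorm_of_posSemidef {m : Type*} [Fintype m] [DecidableEq m] {A : Matrix m m ℂ}
    (hA : A.PosSemidef) : traceNorm A = A.trace.re := by
  have hH := Matrix.isHermitian_conjTranspose_mul_self A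
  -- The eigenvalues of `Aᴴ * A` and of `A` are enumerated independently, so they are compared as
  -- multisets of roots.
  have hchar : (Aᴴ * A).charpoly =
      (Matrix.diagonal fun i => ((hA.1.eigenvalues i ^ 2 : ℝ) : ℂ)).charpoly := by
    conv_lhs => rw [hA.1.eq, hA.1.spectral_theorem]
    rw [← map_mul, Unitary.conjStarAlgAut_apply, Matrix.charpoly_mul_comm, ← mul_assoc]
    simp [Matrix.diagonal_mul_diagonal, pow_two]
  have hroots := congrArg Polynomial.roots hchar
  rw [hH.roots_charpoly_eq_eigenvalues, Matrix.charpoly_diagonal,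
    Polynomial.roots_prod _ _ (Finset.prod_ne_zero_iff.2 fun i _ => Polynomial.X_sub_C_ne_zero _)]
    at hroots
  simp only [Polynomial.roots_X_sub_C, Multiset.bind_singleton] at hroots
  have hsum := congrArg (fun s => (s.map fun z : ℂ => Real.sqrt z.re).sum) hroots
  simp only [Multiset.map_map, Function.comp_def] at hsum
  have hl : traceNorm A = ∑ i, Real.sqrt (hH.eigenvalues i) := rfl
  rw [hl, hA.1.trace_eq_sum_eigenvalues, Complex.re_sum]
  refine Eq.trans ?_ (hsum.trans ?_)
  · rfl
  · refine Finset.sum_congr rfl fun i _ => ?_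
    rw [Complex.ofReal_re, Real.sqrt_sq (hA.eigenvalues_nonneg i)]
    rfl

section elemMatrix

variable {n d d' : ℕ}

lemma conjTranspose_elemMatrix (A : Fin n → Matrix (Fin d) (Fin d') ℂ) :
    (elemMatrix A)ᴴ = elemMatrix fun i => (A i)ᴴ := by
  ext j k
  simp [elemMatrix, Matrix.conjTranspose_apply, star_prod]

lemma elemMatrix_mul {d'' : ℕ} (A : Fin n → Matrix (Fin d) (Fin d') ℂ)
    (B : Fin n → Matrix (Fin d') (Fin d'') ℂ) :
    elemMatrix A * elemMatrix B = elemMatrix fun i => A i * B i := by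
  ext j k
  simp only [elemMatrix, Matrix.mul_apply, Matrix.of_apply, ← Finset.prod_mul_distrib]
  rw [Finset.prod_univ_sum, Fintype.piFinset_univ]

lemma trace_elemMatrix (A : Fin n → Matrix (Fin d) (Fin d) ℂ) :
    (elemMatrix A).trace = ∏ i, (A i).trace := by
  simp only [elemMatrix, Matrix.trace, Matrix.diag_apply, Matrix.of_apply]
  rw [Finset.prod_univ_sum, Fintype.piFinset_univ]

open scoped MatrixOrder in
lemma Matrix.PosSemidef.exists_eq_mul_conjTranspose {m : Type*} [Fintype m]
    {A : Matrix m m ℂ} (hA : A.PosSemidef) : ∃ C : Matrix m m ℂ, A = C * Cᴴ := by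
  classical
  obtain ⟨B, hB⟩ := CStarAlgebra.nonneg_iff_eq_star_mul_self.1 (Matrix.nonneg_iff_posSemidef.2 hA)
  exact ⟨Bᴴ, by rw [hB, Matrix.conjTranspose_conjTranspose]; rfl⟩

lemma posSemidef_elemMatrix {A : Fin n → Matrix (Fin d) (Fin d) ℂ} (hA : ∀ i, (A i).PosSemidef) :
    (elemMatrix A).PosSemidef := by
  choose C hC using fun i => (hA i).exists_eq_mul_conjTranspose
  have : elemMatrix A = elemMatrix C * (elemMatrix C)ᴴ := by
    rw [conjTranspose_elemMatrix, elemMatrix_mul]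
    congr 1
    funext i
    exact hC i
  rw [this]
  exact Matrix.posSemidef_self_mul_conjTranspose _

lemma IsSeparableMatrix.posSemidef {ρ : MultiMatrix n d d} (h : IsSeparableMatrix ρ) :
    ρ.PosSemidef := by
  obtain ⟨m, A, hA, rfl⟩ := h
  exact Matrix.posSemidef_sum _ fun a _ => posSemidef_elemMatrix (hA a)

end elemMatrix

/-! ### Normalized separable decompositions and their limits -/

namespace WSC

variable {n d r : ℕ} {Ω : WSC n}

lemma IsSepDecomp.trace_eq {A : ∀ i : Fin n, Ω.LocalIdx r i → Matrix (Fin d) (Fin d) ℂ}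
    {ρ : MultiMatrix n d d} (h : Ω.IsSepDecomp r A ρ) :
    ρ.trace = ∑ α : Ω.GlobalIdx r, ∏ i, (A i (Ω.restrict α i)).trace := by
  have h1 : ρ = _ := h.1
  rw [h1, Matrix.trace_sum]
  exact Finset.sum_congr rfl fun α _ => trace_elemMatrix _

/-- Every separable decomposition can be rescaled such that all local matrices away from the root
have trace at most one and the traces at the root add up to the trace of the matrix. -/
lemma HasSepDecomp.exists_normalized {ρ : MultiMatrix n d d} (h : Ω.HasSepDecomp r ρ)
    {v : Fin n} (R : Ω.Rooting v) :
    ∃ A : ∀ i : Fin n, Ω.LocalIdx r i → Matrix (Fin d) (Fin d) ℂ,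
      Ω.IsSepDecomp r A ρ ∧ (∀ i, i ≠ v → ∀ β, (A i β).trace.re ≤ 1) ∧
      ∑ β : Ω.LocalIdx r v, (A v β).trace = ρ.trace := by
  obtain ⟨A, hA⟩ := h
  have htr : ∀ i β, (A i β).trace = ((A i β).trace.re : ℂ) := fun i β => by
    have := (hA.2 i β).trace_nonneg
    rw [Complex.nonneg_iff] at this
    exact Complex.ext rfl (by simpa using this.2.symm)
  obtain ⟨c, hc0, hc1, hc2, hc3⟩ := R.exists_rescaling (fun i β => (A i β).trace.re)
    (fun i β => (Complex.nonneg_iff.1 (hA.2 i β).trace_nonneg).1)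
  refine ⟨fun i β => (c i β : ℂ) • A i β, ⟨?_, fun i β => ?_⟩, fun i hi β => ?_, ?_⟩
  · have h1 : ρ = _ := hA.1
    rw [IsMatrixDecomp, h1]
    refine Finset.sum_congr rfl fun α _ => ?_
    ext j k
    simp only [elemMatrix, Matrix.of_apply, Matrix.smul_apply, smul_eq_mul,
      Finset.prod_mul_distrib]
    rcases hc1 α with h | ⟨i, hi⟩
    · rw [← Complex.ofReal_prod, h, Complex.ofReal_one, one_mul]
    -- A psd matrix of trace zero is zero, so this summand vanishes whatever the factors are.
    · have hz : A i (Ω.restrict α i) = 0 := by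
        rw [← (hA.2 _ _).trace_eq_zero_iff, htr, hi, Complex.ofReal_zero]
      rw [Finset.prod_eq_zero (f := fun i => A i (Ω.restrict α i) (j i) (k i))
        (Finset.mem_univ i) (by rw [hz]; rfl), mul_zero]
  · exact (hA.2 i β).smul (Complex.zero_le_real.2 (hc0 i β))
  · rw [Matrix.trace_smul, smul_eq_mul, Complex.re_ofReal_mul]
    exact hc2 i hi β
  · simp only [Matrix.trace_smul, smul_eq_mul]
    rw [hA.trace_eq]
    have := congrArg (fun x : ℝ => (x : ℂ)) hc3
    simp only [Complex.ofReal_sum, Complex.ofReal_mul, Complex.ofReal_prod, ← htr] at this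
    exact this

lemma HasSepDecomp.of_tendsto {v : Fin n} (R : Ω.Rooting v) {u : ℕ → MultiMatrix n d d}
    {ρ : MultiMatrix n d d} (hu : Tendsto u atTop (𝓝 ρ)) (h : ∀ k, Ω.HasSepDecomp r (u k)) :
    Ω.HasSepDecomp r ρ := by
  choose A hA hA1 hAv using fun k => (h k).exists_normalized R
  have htrace : Tendsto (fun k => (u k).trace.re) atTop (𝓝 ρ.trace.re) := by
    have : Continuous fun M : MultiMatrix n d d => M.trace.re :=
      Complex.continuous_re.comp (continuous_id.matrix_trace)
    exact (this.tendsto ρ).comp hu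
  obtain ⟨C, hC⟩ := htrace.bddAbove_range
  have hnn : ∀ k i β, 0 ≤ (A k i β).trace.re := fun k i β =>
    (Complex.nonneg_iff.1 ((hA k).2 i β).trace_nonneg).1
  -- At the root, a single trace is at most the sum of all of them, which is the convergent trace of
  -- `u k`.
  have htr : ∀ k i β, (A k i β).trace.re ≤ max 1 C := by
    intro k i β
    by_cases hi : i = v
    · subst hi
      refine le_trans ?_ (le_max_right _ _)
      refine le_trans ?_ (hC ⟨k, rfl⟩)
      change _ ≤ (u k).trace.re
      rw [← hAv k, Complex.re_sum]
      exact Finset.single_le_sum (f := fun β => (A k i β).trace.re) (fun β _ => hnn k i β)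
        (Finset.mem_univ β)
    · exact (hA1 k i hi β).trans (le_max_left _ _)
  have hC0 : (0 : ℝ) ≤ max 1 C := zero_le_one.trans (le_max_left _ _)
  let a : ℕ → ∀ i : Fin n, Ω.LocalIdx r i → Fin d → Fin d → ℂ := fun k i β x y => A k i β x y
  have ha : ∀ k, a k ∈ Metric.closedBall (0 : ∀ i : Fin n, Ω.LocalIdx r i → Fin d → Fin d → ℂ)
      (max 1 C) := by
    intro k
    rw [mem_closedBall_zero_iff, pi_norm_le_iff_of_nonneg hC0]
    intro i
    rw [pi_norm_le_iff_of_nonneg hC0]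
    intro β
    rw [pi_norm_le_iff_of_nonneg hC0]
    intro x
    rw [pi_norm_le_iff_of_nonneg hC0]
    intro y
    exact (((hA k).2 i β).norm_apply_le_trace x y).trans (htr k i β)
  obtain ⟨b, -, φ, hφ, hlim⟩ := tendsto_subseq_of_bounded Metric.isBounded_closedBall ha
  have hlim' : ∀ i β x y, Tendsto (fun k => A (φ k) i β x y) atTop (𝓝 (b i β x y)) := by
    intro i β x y
    have h1 := tendsto_pi_nhds.1 hlim i
    have h2 := tendsto_pi_nhds.1 h1 β
    have h3 := tendsto_pi_nhds.1 h2 x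
    exact tendsto_pi_nhds.1 h3 y
  refine ⟨fun i β => Matrix.of (b i β), ?_, fun i β => ?_⟩
  · ext j k
    have h1 : Tendsto (fun m => u (φ m) j k) atTop (𝓝 (ρ j k)) := by
      have h1 := tendsto_pi_nhds.1 (hu.comp hφ.tendsto_atTop) j
      exact tendsto_pi_nhds.1 h1 k
    refine tendsto_nhds_unique h1 ?_
    have h2 : ∀ m, u (φ m) j k = ∑ α : Ω.GlobalIdx r, ∏ i,
        A (φ m) i (Ω.restrict α i) (j i) (k i) := by
      intro m
      have h3 : u (φ m) = _ := (hA (φ m)).1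
      rw [h3, Matrix.sum_apply]
      rfl
    simp_rw [h2, Matrix.sum_apply]
    exact tendsto_finsetSum _ fun α _ => tendsto_finsetProd _ fun i _ => hlim' _ _ _ _
  · have hcl : IsClosed {M : Matrix (Fin d) (Fin d) ℂ | M.PosSemidef} := by
      simp only [Matrix.posSemidef_iff_dotProduct_mulVec, Set.ofPred_and, Set.ofPred_forall]
      refine IsClosed.inter (isClosed_eq continuous_id.matrix_conjTranspose continuous_id)
        (isClosed_iInter fun x => ?_)
      exact isClosed_le continuous_const
        (continuous_const.dotProduct (continuous_id.matrix_mulVec continuous_const))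
    have hten : Tendsto (fun m => A (φ m) i β) atTop (𝓝 (Matrix.of (b i β))) :=
      tendsto_pi_nhds.2 fun x => tendsto_pi_nhds.2 fun y => hlim' i β x y
    exact hcl.mem_of_tendsto hten (Eventually.of_forall fun m => (hA (φ m)).2 i β)

end WSC

/-! ### Ranks as attained minima, and diagonal matrices -/

lemma iInf_natCast_le_iff {P : ℕ → Prop} (hP : ∀ r s, r ≤ s → P r → P s) (r : ℕ) :
    (⨅ (s : ℕ) (_ : P s), (s : ℕ∞)) ≤ r ↔ P r := by
  constructor
  · intro h
    by_contra hr
    have h1 : ((r + 1 : ℕ) : ℕ∞) ≤ ⨅ (s : ℕ) (_ : P s), (s : ℕ∞) := by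
      refine le_iInf₂ fun s hs => ?_
      rw [Nat.cast_le]
      by_contra hlt
      exact hr (hP s r (by omega) hs)
    have := h1.trans h
    rw [Nat.cast_le] at this
    omega
  · intro h
    exact iInf₂_le r h

lemma borderRank_eq {X : Type*} [TopologicalSpace X] {R : X → ℕ∞} {x : X}
    (h : ∀ (r : ℕ) (u : ℕ → X), Tendsto u atTop (𝓝 x) → (∀ k, R (u k) ≤ r) → R x ≤ r) :
    borderRank R x = R x := by
  apply le_antisymm
  · exact sInf_le ⟨fun _ => x, tendsto_const_nhds, fun _ => le_rfl⟩
  · refine le_sInf ?_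
    rintro s ⟨u, hu, hs⟩
    induction s using ENat.recTopCoe with
    | top => exact le_top
    | coe r => exact h r u hu hs

namespace WSC

variable {n d d' : ℕ} {Ω : WSC n}

/-- Padding by zero: a value outside the first `r` on some facet is seen by a vertex of that facet,
whose local matrix is zero. The last clause lets psd properties survive. -/
lemma IsMatrixDecomp.exists_of_le (v : Fin n) {r s : ℕ} (hrs : r ≤ s)
    {A : ∀ i : Fin n, Ω.LocalIdx r i → Matrix (Fin d) (Fin d') ℂ} {ρ : MultiMatrix n d d'}
    (h : Ω.IsMatrixDecomp r A ρ) :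
    ∃ B : ∀ i : Fin n, Ω.LocalIdx s i → Matrix (Fin d) (Fin d') ℂ,
      Ω.IsMatrixDecomp s B ρ ∧ ∀ i β, B i β = 0 ∨ ∃ β', B i β = A i β' := by
  classical
  refine ⟨fun i β => if h : ∀ F, (β F : ℕ) < r then A i fun F => ⟨β F, h F⟩ else 0, ?_, ?_⟩
  · have h1 : ρ = _ := h
    rw [IsMatrixDecomp, h1]
    refine Finset.sum_of_injOn (fun α F => Fin.castLE hrs (α F)) ?_ ?_ ?_ ?_
    · intro α _ α' _ hα
      funext F
      exact Fin.castLE_injective hrs (congrFun hα F)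
    · simp
    · intro α _ hα
      have : ∃ F, ¬ (α F : ℕ) < r := by
        by_contra hcon
        push Not at hcon
        exact hα ⟨fun F => ⟨α F, hcon F⟩, by simp, rfl⟩
      obtain ⟨F, hF⟩ := this
      obtain ⟨i, hi⟩ := F.1.2.nonempty v
      ext j k
      simp only [elemMatrix, Matrix.of_apply]
      refine Finset.prod_eq_zero (Finset.mem_univ i) ?_
      rw [dif_neg fun h => hF (h ⟨F, hi⟩)]
      rfl
    · intro α _
      refine congrArg elemMatrix (funext fun i => ?_)
      have hlt : ∀ F : Ω.FacetCopyAt i,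
          (Ω.restrict (fun F => Fin.castLE hrs (α F)) i F : ℕ) < r := fun F => (α F.1).2
      rw [dif_pos hlt]
      rfl
  · intro i β
    by_cases hβ : ∀ F, (β F : ℕ) < r
    · exact Or.inr ⟨_, dif_pos hβ⟩
    · exact Or.inl (dif_neg hβ)

lemma HasSepDecomp.mono (v : Fin n) {r s : ℕ} (hrs : r ≤ s) {ρ : MultiMatrix n d d}
    (h : Ω.HasSepDecomp r ρ) : Ω.HasSepDecomp s ρ := by
  obtain ⟨A, hA, hpsd⟩ := h
  obtain ⟨B, hB, hBA⟩ := hA.exists_of_le v hrs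
  refine ⟨B, hB, fun i β => ?_⟩
  rcases hBA i β with h | ⟨β', h⟩
  · rw [h]
    exact Matrix.PosSemidef.zero
  · rw [h]
    exact hpsd i β'

lemma HasPurification.mono (v : Fin n) {r s : ℕ} (hrs : r ≤ s) {ρ : MultiMatrix n d d}
    (h : Ω.HasPurification r ρ) : Ω.HasPurification s ρ := by
  obtain ⟨d', L, A, hL, hA⟩ := h
  obtain ⟨B, hB, -⟩ := hA.exists_of_le v hrs
  exact ⟨d', L, B, hL, hB⟩

lemma sepRank_le_iff (v : Fin n) {ρ : MultiMatrix n d d} {r : ℕ} :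
    Ω.sepRank ρ ≤ r ↔ Ω.HasSepDecomp r ρ :=
  iInf_natCast_le_iff (fun _ _ hrs h => h.mono v hrs) r

lemma puriRank_le_iff (v : Fin n) {ρ : MultiMatrix n d d} {r : ℕ} :
    Ω.puriRank ρ ≤ r ↔ Ω.HasPurification r ρ :=
  iInf_natCast_le_iff (fun _ _ hrs h => h.mono v hrs) r

lemma prod_diagonal_apply (w : Fin n → Fin d → ℂ) (j k : Fin n → Fin d) :
    ∏ i, Matrix.diagonal (w i) (j i) (k i) = Matrix.diagonal (elemTensor w) j k := by
  by_cases h : j = k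
  · subst h
    simp [elemTensor]
  · rw [Matrix.diagonal_apply_ne _ h]
    obtain ⟨i, hi⟩ := Function.ne_iff.1 h
    exact Finset.prod_eq_zero (Finset.mem_univ i) (Matrix.diagonal_apply_ne _ hi)

lemma hasNNDecomp_iff {r : ℕ} {T : Tensor n d} :
    Ω.HasNNDecomp r T ↔ Ω.HasSepDecomp r (Matrix.diagonal T : MultiMatrix n d d) := by
  constructor
  · rintro ⟨w, hw, rfl⟩
    refine ⟨fun i β => Matrix.diagonal (w i β), ?_, fun i β =>
      Matrix.PosSemidef.diagonal fun j => hw i β j⟩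
    ext j k
    rw [Matrix.sum_apply]
    simp only [elemMatrix, Matrix.of_apply, prod_diagonal_apply]
    by_cases h : j = k
    · subst h
      simp
    · simp [h]
  · rintro ⟨A, hA, hpsd⟩
    refine ⟨fun i β j => A i β j j, fun i β j => (hpsd i β).diag_nonneg, ?_⟩
    funext j
    have h1 : (Matrix.diagonal T : MultiMatrix n d d) = _ := hA
    have := congrFun (congrFun h1 j) j
    rw [Matrix.diagonal_apply_eq, Matrix.sum_apply] at this
    rw [this, Finset.sum_apply]
    rfl

lemma nnRank_eq_sepRank (T : Tensor n d) :
    Ω.nnRank T = Ω.sepRank (Matrix.diagonal T : MultiMatrix n d d) := by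
  simp only [nnRank, sepRank, hasNNDecomp_iff]

end WSC

/-! ### Gram-Schmidt families -/

/-- A finite family factors through an orthogonal family of vectors of norm one or zero. -/
lemma exists_orthogonal_family {ι : Type*} [Fintype ι] {r : ℕ} (w : Fin r → ι → ℂ) :
    ∃ (q : Fin r → ι → ℂ) (G : Fin r → Fin r → ℂ),
      (∀ b, q b ∈ Submodule.span ℂ (Set.range w)) ∧ (∀ a x, w a x = ∑ b, G a b * q b x) ∧
      (∀ b x, ‖q b x‖ ≤ 1) ∧
      ∀ b, (∀ a, G a b = 0) ∨ ∀ b', ∑ x, star (q b x) * q b' x = if b = b' then 1 else 0 := by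
  classical
  set f : Fin r → EuclideanSpace ℂ ι := fun a => WithLp.toLp 2 (w a) with hf
  set g : Fin r → EuclideanSpace ℂ ι := InnerProductSpace.gramSchmidtNormed ℂ f with hg
  have horth : ∀ b b', b ≠ b' → inner ℂ (g b) (g b') = 0 := by
    intro b b' h
    simp only [hg, InnerProductSpace.gramSchmidtNormed, inner_smul_left, inner_smul_right,
      InnerProductSpace.gramSchmidt_orthogonal ℂ f h, mul_zero]
  have hunit : ∀ b, g b ≠ 0 → inner ℂ (g b) (g b) = 1 := by
    intro b h
    rw [inner_self_eq_norm_sq_to_K, InnerProductSpace.gramSchmidtNormed_unit_length' h]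
    simp
  have hnorm : ∀ b, ‖g b‖ ≤ 1 := by
    intro b
    by_cases h : g b = 0
    · simp [h]
    · exact (InnerProductSpace.gramSchmidtNormed_unit_length' h).le
  have hspan : Submodule.span ℂ (Set.range g) = Submodule.span ℂ (Set.range f) := by
    rw [hg, InnerProductSpace.span_gramSchmidtNormed_range, InnerProductSpace.span_gramSchmidt]
  have hexp : ∀ a, f a = ∑ b, inner ℂ (g b) (f a) • g b := by
    intro a
    have : f a ∈ Submodule.span ℂ (Set.range g) := by
      rw [hspan]
      exact Submodule.subset_span ⟨a, rfl⟩
    obtain ⟨c, hc⟩ := (Submodule.mem_span_range_iff_exists_fun ℂ).1 this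
    conv_lhs => rw [← hc]
    refine Finset.sum_congr rfl fun b _ => ?_
    by_cases h : g b = 0
    · simp [h]
    · congr 1
      rw [← hc, inner_sum, Finset.sum_eq_single b]
      · rw [inner_smul_right, hunit b h, mul_one]
      · intro b' _ hb'
        rw [inner_smul_right, horth b b' hb'.symm, mul_zero]
      · simp
  refine ⟨fun b x => g b x, fun a b => inner ℂ (g b) (f a), ?_, ?_, ?_, ?_⟩
  · intro b
    have h1 : g b ∈ Submodule.span ℂ (Set.range f) := by
      rw [← hspan]
      exact Submodule.subset_span ⟨b, rfl⟩
    obtain ⟨c, hc⟩ := (Submodule.mem_span_range_iff_exists_fun ℂ).1 h1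
    refine (Submodule.mem_span_range_iff_exists_fun ℂ).2 ⟨c, ?_⟩
    funext x
    have := congrArg (fun y : EuclideanSpace ℂ ι => y x) hc
    simpa [hf, Finset.sum_apply] using this
  · intro a x
    have := congrArg (fun y : EuclideanSpace ℂ ι => y x) (hexp a)
    simpa [hf, Finset.sum_apply] using this
  · intro b x
    exact (PiLp.norm_apply_le (g b) x).trans (hnorm b)
  · intro b
    -- Gram-Schmidt leaves a zero vector at linearly dependent positions, and its coefficients,
    -- being inner products with it, vanish.
    by_cases h : g b = 0
    · left
      intro a
      simp [h]
    · right
      intro b'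
      have h1 : ∑ x, star (g b x) * g b' x = inner ℂ (g b) (g b') := by
        rw [PiLp.inner_apply]
        refine Finset.sum_congr rfl fun x _ => ?_
        simp [mul_comm]
      rw [h1]
      split_ifs with hb
      · subst hb
        exact hunit b h
      · exact horth b b' hb

/-! ### Contractions over subtrees -/

namespace WSC

lemma restrict_update_of_mem {n r : ℕ} {Ω : WSC n} (α : Ω.GlobalIdx r) {F : Ω.FacetCopy} {i : Fin n}
    (h : i ∈ F.1.1) (a : Fin r) :
    Ω.restrict (Function.update α F a) i = Function.update (Ω.restrict α i) ⟨F, h⟩ a := by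
  funext G
  by_cases hG : G = ⟨F, h⟩
  · subst hG
    simp [restrict]
  · have : G.1 ≠ F := fun h' => hG (Subtype.ext h')
    simp [restrict, hG, this]

lemma restrict_update_of_notMem {n r : ℕ} {Ω : WSC n} (α : Ω.GlobalIdx r) {F : Ω.FacetCopy}
    {i : Fin n} (h : i ∉ F.1.1) (a : Fin r) :
    Ω.restrict (Function.update α F a) i = Ω.restrict α i := by
  funext G
  have : G.1 ≠ F := fun h' => h (h' ▸ G.2)
  simp [restrict, this]

namespace Rooting

variable {n r : ℕ} {Ω : WSC n} {v : Fin n} (R : Ω.Rooting v) {D : Type*}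

/-- The contraction of the local tensors at the root and at the vertices in `I` along the parent
edges of the vertices in `I`. -/
noncomputable def net (A : ∀ i : Fin n, Ω.LocalIdx r i → D → ℂ) (I : Finset (Fin n))
    (α : Ω.GlobalIdx r) (j : Fin n → D) : ℂ :=
  ∑ γ : Ω.GlobalIdx r with ∀ F, F ∉ I.image R.edge → γ F = α F,
    ∏ i ∈ insert v I, A i (Ω.restrict γ i) (j i)

/-- `I` is a set of vertices other than the root that is closed under taking parents. -/
def IsUpper (I : Finset (Fin n)) : Prop :=
  v ∉ I ∧ ∀ w ∈ I, R.par w ∈ insert v I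

/-- `u` can be attached as a new leaf to the subtree with vertices `insert v I`. -/
structure IsLeafOver (u : Fin n) (I : Finset (Fin n)) : Prop where
  isUpper : R.IsUpper I
  ne_root : u ≠ v
  notMem : u ∉ insert v I
  par_mem : R.par u ∈ insert v I

variable {R}

lemma IsUpper.ne_root {I : Finset (Fin n)} (hI : R.IsUpper I) {w : Fin n} (hw : w ∈ I) : w ≠ v :=
  fun h => hI.1 (h ▸ hw)

lemma IsUpper.exists_leaf {I : Finset (Fin n)} (hI : R.IsUpper I) (hne : I.Nonempty) :
    ∃ u J, I = insert u J ∧ J.card < I.card ∧ R.IsLeafOver u J := by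
  classical
  obtain ⟨u, huI, hmax⟩ := Finset.exists_max_image I R.depth hne
  have hpar : ∀ w ∈ I, R.par w ∈ insert v (I.erase u) := by
    intro w hw
    have h1 := hI.2 w hw
    rw [Finset.mem_insert] at h1 ⊢
    refine h1.imp_right fun h => Finset.mem_erase.2 ⟨?_, h⟩
    intro h'
    have h2 := R.depth_par w (hI.ne_root hw)
    have h3 := hmax w hw
    rw [h'] at h2
    omega
  exact ⟨u, I.erase u, (Finset.insert_erase huI).symm, Finset.card_erase_lt_of_mem huI,
    ⟨fun h => hI.1 (Finset.mem_of_mem_erase h), fun w hw => hpar w (Finset.mem_of_mem_erase hw)⟩,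
    hI.ne_root huI, by simp [hI.ne_root huI], hpar u huI⟩

namespace IsLeafOver

variable {u : Fin n} {I : Finset (Fin n)}

lemma edge_notMem (h : R.IsLeafOver u I) : R.edge u ∉ I.image R.edge := by
  intro he
  obtain ⟨w, hw, hwe⟩ := Finset.mem_image.1 he
  have := R.edge_injective (h.isUpper.ne_root hw) h.ne_root hwe
  subst this
  exact h.notMem (Finset.mem_insert_of_mem hw)

lemma notMem_edge (h : R.IsLeafOver u I) {w : Fin n} (hw : w ∈ I) : u ∉ (R.edge w).1.1 := by
  intro hu
  rcases (R.mem_edge w (h.isUpper.ne_root hw) u).1 hu with rfl | h'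
  · exact h.notMem (Finset.mem_insert_of_mem hw)
  · exact h.notMem (h' ▸ h.isUpper.2 w hw)

lemma restrict_eq (h : R.IsLeafOver u I)
    {α α' : Ω.GlobalIdx r} (hα : ∀ F, F ∉ I.image R.edge → α' F = α F) :
    Ω.restrict α' u = Ω.restrict α u := by
  funext F
  refine hα F.1 fun hF => ?_
  obtain ⟨w, hw, hwe⟩ := Finset.mem_image.1 hF
  exact h.notMem_edge hw (hwe ▸ F.2)

lemma notMem_edge_of_ne (h : R.IsLeafOver u I) {i : Fin n} (hi : i ∈ insert v I)
    (hne : i ≠ R.par u) : i ∉ (R.edge u).1.1 := by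
  intro hmem
  rcases (R.mem_edge u h.ne_root i).1 hmem with rfl | h'
  · exact h.notMem hi
  · exact hne h'

lemma eq_edge_of_mem (h : R.IsLeafOver u I)
    {F : Ω.FacetCopy} (hu : u ∈ F.1.1) {i : Fin n} (hi : i ∈ insert v I)
    (hiF : i ∈ F.1.1) : F = R.edge u := by
  rcases R.eq_edge F i u hiF hu (fun h' => h.notMem (h' ▸ hi)) with h' | h'
  · exact h'.2.1
  · have hiI := (Finset.mem_insert.1 hi).resolve_left h'.1
    have := h.isUpper.2 i hiI
    rw [← h'.2.2] at this
    exact absurd this h.notMem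

/-- A new leaf meets the subtree only in its parent edge, so attaching it means summing over that
one index. -/
lemma net_insert (h : R.IsLeafOver u I)
    (A : ∀ i : Fin n, Ω.LocalIdx r i → D → ℂ) (α : Ω.GlobalIdx r) (j : Fin n → D) :
    R.net A (insert u I) α j =
      ∑ a, A u (Ω.restrict (Function.update α (R.edge u) a) u) (j u) *
        R.net A I (Function.update α (R.edge u) a) j := by
  classical
  unfold net
  rw [← Finset.sum_fiberwise _ (fun α' : Ω.GlobalIdx r => α' (R.edge u))]
  refine Finset.sum_congr rfl fun a _ => ?_
  rw [Finset.mul_sum]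
  refine Finset.sum_congr ?_ fun α' hα' => ?_
  · ext α'
    simp only [Finset.mem_filter, Finset.mem_univ, true_and, Finset.image_insert,
      Finset.mem_insert, not_or]
    constructor
    · rintro ⟨h1, h2⟩ F hF
      by_cases hFu : F = R.edge u
      · subst hFu
        simp [h2]
      · rw [Function.update_of_ne hFu]
        exact h1 F ⟨hFu, hF⟩
    · intro h1
      refine ⟨fun F hF => ?_, ?_⟩
      · rw [h1 F hF.2, Function.update_of_ne hF.1]
      · rw [h1 _ h.edge_notMem, Function.update_self]
  · simp only [Finset.mem_filter, Finset.mem_univ, true_and] at hα'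
    rw [Finset.insert_comm, Finset.prod_insert h.notMem, h.restrict_eq hα']

/-- The edge of `u` is an open leg of the subtree, attached only to the parent. A change of basis on
that leg of the parent therefore acts linearly on the whole contraction. -/
lemma net_update_par (h : R.IsLeafOver u I)
    (A : ∀ i : Fin n, Ω.LocalIdx r i → D → ℂ)
    (G : Fin r → Fin r → ℂ) (α : Ω.GlobalIdx r) (j : Fin n → D) (b : Fin r) :
    R.net (Function.update A (R.par u) fun β x =>
        ∑ a, G a (β ⟨R.edge u, R.par_mem_edge h.ne_root⟩) *
          A (R.par u) (Function.update β ⟨R.edge u, R.par_mem_edge h.ne_root⟩ a) x) I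
      (Function.update α (R.edge u) b) j =
      ∑ a, G a b * R.net A I (Function.update α (R.edge u) a) j := by
  classical
  -- Moves the dependence on `a` from the summation range into the summand, so that the sums can be
  -- exchanged.
  have hre : ∀ a : Fin r, R.net A I (Function.update α (R.edge u) a) j =
      ∑ α' : Ω.GlobalIdx r with ∀ F, F ∉ I.image R.edge →
          α' F = Function.update α (R.edge u) b F,
        ∏ i ∈ insert v I, A i (Ω.restrict (Function.update α' (R.edge u) a) i) (j i) := by
    intro a
    unfold net
    refine Finset.sum_bij' (fun α' _ => Function.update α' (R.edge u) b)
      (fun α' _ => Function.update α' (R.edge u) a) ?_ ?_ ?_ ?_ ?_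
    · intro α' hα'
      simp only [Finset.mem_filter, Finset.mem_univ, true_and] at hα' ⊢
      intro F hF
      have := hα' F hF
      by_cases hFu : F = R.edge u
      · subst hFu
        simp
      · rw [Function.update_of_ne hFu] at this ⊢
        rw [Function.update_of_ne hFu, this]
    · intro α' hα'
      simp only [Finset.mem_filter, Finset.mem_univ, true_and] at hα' ⊢
      intro F hF
      have := hα' F hF
      by_cases hFu : F = R.edge u
      · subst hFu
        simp
      · rw [Function.update_of_ne hFu] at this ⊢
        rw [Function.update_of_ne hFu, this]
    · intro α' hα'
      simp only [Finset.mem_filter, Finset.mem_univ, true_and] at hα'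
      have := hα' _ h.edge_notMem
      rw [Function.update_self] at this
      rw [Function.update_idem, ← this, Function.update_eq_self]
    · intro α' hα'
      simp only [Finset.mem_filter, Finset.mem_univ, true_and] at hα'
      have := hα' _ h.edge_notMem
      rw [Function.update_self] at this
      rw [Function.update_idem, ← this, Function.update_eq_self]
    · intro α' hα'
      simp only [Finset.mem_filter, Finset.mem_univ, true_and] at hα'
      have := hα' _ h.edge_notMem
      rw [Function.update_self] at this
      rw [Function.update_idem, ← this, Function.update_eq_self]
  simp_rw [hre, Finset.mul_sum]
  rw [Finset.sum_comm, net]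
  refine Finset.sum_congr rfl fun α' hα' => ?_
  simp only [Finset.mem_filter, Finset.mem_univ, true_and] at hα'
  have hb : α' (R.edge u) = b := by
    rw [hα' _ h.edge_notMem, Function.update_self]
  rw [← Finset.mul_prod_erase _ _ h.par_mem, Function.update_self, Finset.sum_mul]
  refine Finset.sum_congr rfl fun a _ => ?_
  rw [← Finset.mul_prod_erase _ _ h.par_mem, restrict_update_of_mem _ (R.par_mem_edge h.ne_root),
    mul_assoc]
  congr 1
  · rw [← hb]
    rfl
  · congr 1
    refine Finset.prod_congr rfl fun i hi => ?_
    rw [Finset.mem_erase] at hi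
    rw [Function.update_of_ne hi.1, restrict_update_of_notMem _ (h.notMem_edge_of_ne hi.2 hi.1)]

end IsLeafOver

lemma net_congr {I : Finset (Fin n)}
    {A A' : ∀ i : Fin n, Ω.LocalIdx r i → D → ℂ} (hA : ∀ i ∈ insert v I, A i = A' i)
    {α α' : Ω.GlobalIdx r} (hα : ∀ F : Ω.FacetCopy, ∀ i ∈ insert v I, i ∈ F.1.1 → α F = α' F)
    {j j' : Fin n → D} (hj : ∀ i ∈ insert v I, j i = j' i) :
    R.net A I α j = R.net A' I α' j' := by
  classical
  unfold net
  have key : ∀ γ γ' : Ω.GlobalIdx r,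
      (∀ F : Ω.FacetCopy, ∀ i ∈ insert v I, i ∈ F.1.1 → γ F = γ' F) →
      ∀ i ∈ insert v I, Ω.restrict γ i = Ω.restrict γ' i := by
    intro γ γ' hγ i hi
    funext F
    exact hγ F.1 i hi F.2
  refine Finset.sum_bij' (fun γ _ F => if F ∈ I.image R.edge then γ F else α' F)
    (fun γ _ F => if F ∈ I.image R.edge then γ F else α F) ?_ ?_ ?_ ?_ ?_
  · intro γ hγ
    simp only [Finset.mem_filter, Finset.mem_univ, true_and]
    intro F hF
    rw [if_neg hF]
  · intro γ hγ
    simp only [Finset.mem_filter, Finset.mem_univ, true_and]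
    intro F hF
    rw [if_neg hF]
  · intro γ hγ
    simp only [Finset.mem_filter, Finset.mem_univ, true_and] at hγ
    funext F
    by_cases hF : F ∈ I.image R.edge
    · simp only [if_pos hF]
    · simp only [if_neg hF, hγ F hF]
  · intro γ hγ
    simp only [Finset.mem_filter, Finset.mem_univ, true_and] at hγ
    funext F
    by_cases hF : F ∈ I.image R.edge
    · simp only [if_pos hF]
    · simp only [if_neg hF, hγ F hF]
  · intro γ hγ
    simp only [Finset.mem_filter, Finset.mem_univ, true_and] at hγ
    refine Finset.prod_congr rfl fun i hi => ?_
    rw [hA i hi, hj i hi]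
    congr 1
    refine key _ _ ?_ i hi
    intro F k hk hkF
    split_ifs with hF
    · rfl
    · rw [hγ F hF, hα F k hk hkF]

end Rooting

end WSC

/-! ### Closedness of tree contractions -/

namespace WSC.Rooting

variable {n r : ℕ} {Ω : WSC n} {v : Fin n} {R : Ω.Rooting v} {D : Type*} [Fintype D]

/-- The tensor at a leaf can be chosen bounded, such that the contraction of the remaining tensors
is controlled by the whole contraction. -/
lemma IsLeafOver.exists_orthogonalized {u : Fin n} {I : Finset (Fin n)} (h : R.IsLeafOver u I)
    (A : ∀ i : Fin n, Ω.LocalIdx r i → D → ℂ) :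
    ∃ (q : Ω.LocalIdx r u → D → ℂ) (A' : ∀ i : Fin n, Ω.LocalIdx r i → D → ℂ),
      (∀ β x, ‖q β x‖ ≤ 1) ∧
      (∀ α j, R.net A (insert u I) α j =
        ∑ b, q (Ω.restrict (Function.update α (R.edge u) b) u) (j u) *
          R.net A' I (Function.update α (R.edge u) b) j) ∧
      ∀ α j, ‖R.net A' I α j‖ ≤
        Fintype.card (Ω.LocalIdx r u × D) * ‖R.net A (insert u I)‖ := by
  classical
  set e : Ω.FacetCopyAt u := ⟨R.edge u, R.mem_edge_self h.ne_root⟩ with he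
  -- The leaf tensor is read as `r` vectors, one per value on the parent edge. The slot `e` of `p.1`
  -- is overwritten, hence a dummy; `hq` uses the span condition to show that the new vectors ignore
  -- it too.
  obtain ⟨q, G, hspan, hexp, hle, horth⟩ := exists_orthogonal_family
    (fun (a : Fin r) (p : Ω.LocalIdx r u × D) => A u (Function.update p.1 e a) p.2)
  have hq : ∀ b β c x, q b (Function.update β e c, x) = q b (β, x) := by
    intro b β c x
    obtain ⟨k, hk⟩ := (Submodule.mem_span_range_iff_exists_fun ℂ).1 (hspan b)
    rw [← hk]
    simp [Finset.sum_apply]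
  have hup : ∀ (α : Ω.GlobalIdx r) b, Ω.restrict (Function.update α (R.edge u) b) u =
      Function.update (Ω.restrict α u) e b := fun α b => restrict_update_of_mem α e.2 b
  set A' := Function.update A (R.par u) fun β x =>
        ∑ a, G a (β ⟨R.edge u, R.par_mem_edge h.ne_root⟩) *
          A (R.par u) (Function.update β ⟨R.edge u, R.par_mem_edge h.ne_root⟩ a) x with hA'
  have hlin := fun α j b => h.net_update_par A G α j b
  rw [← hA'] at hlin
  have hnet : ∀ α j, R.net A (insert u I) α j =
      ∑ b, q b (Ω.restrict α u, j u) * R.net A' I (Function.update α (R.edge u) b) j := by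
    intro α j
    rw [h.net_insert]
    simp_rw [hlin, Finset.mul_sum]
    rw [Finset.sum_comm]
    refine Finset.sum_congr rfl fun a _ => ?_
    have := hexp a (Ω.restrict α u, j u)
    simp only at this
    rw [hup, this, Finset.sum_mul]
    refine Finset.sum_congr rfl fun b _ => ?_
    ring
  refine ⟨fun β x => q (β e) (β, x), A', fun β x => hle _ _, ?_, ?_⟩
  · intro α j
    rw [hnet]
    refine Finset.sum_congr rfl fun b _ => ?_
    simp only [hup, Function.update_self, hq]
  · intro α j
    -- Either the absorbed coefficients vanish and so does the remaining contraction, or pairing the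
    -- full contraction with the unit vector recovers it as in `hrec`. The constant counts the terms
    -- of that pairing.
    rcases horth (α (R.edge u)) with hz | ho
    · have := hlin α j (α (R.edge u))
      rw [Function.update_eq_self] at this
      rw [this]
      simp only [hz, zero_mul, Finset.sum_const_zero, norm_zero]
      positivity
    · let γ : Ω.LocalIdx r u → Ω.GlobalIdx r := fun β F =>
        if h : u ∈ F.1.1 then β ⟨F, h⟩ else α F
      have hγ : ∀ β, Ω.restrict (γ β) u = β := by
        intro β
        funext F
        simp [restrict, γ, F.2]
      have hY : ∀ β x b, R.net A' I (Function.update (γ β) (R.edge u) b) (Function.update j u x) =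
          R.net A' I (Function.update α (R.edge u) b) j := by
        intro β x b
        refine net_congr (fun _ _ => rfl) ?_ ?_
        · intro F i hi hiF
          by_cases hF : F = R.edge u
          · subst hF
            simp
          · have huF : u ∉ F.1.1 := fun hu => hF (h.eq_edge_of_mem hu hi hiF)
            rw [Function.update_of_ne hF, Function.update_of_ne hF]
            simp [γ, huF]
        · intro i hi
          rw [Function.update_of_ne]
          rintro rfl
          exact h.notMem hi
      have hrec : R.net A' I α j = ∑ p : Ω.LocalIdx r u × D, star (q (α (R.edge u)) p) *
          R.net A (insert u I) (γ p.1) (Function.update j u p.2) := by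
        simp_rw [hnet, hγ, hY, Function.update_self, Finset.mul_sum]
        rw [Finset.sum_comm]
        have : ∀ b, ∑ p : Ω.LocalIdx r u × D, star (q (α (R.edge u)) p) *
            (q b (p.1, p.2) * R.net A' I (Function.update α (R.edge u) b) j) =
            (if α (R.edge u) = b then 1 else 0) *
              R.net A' I (Function.update α (R.edge u) b) j := by
          intro b
          rw [← ho b, Finset.sum_mul]
          refine Finset.sum_congr rfl fun p _ => ?_
          rw [mul_assoc]
        simp_rw [this]
        simp
      rw [hrec]
      refine (norm_sum_le _ _).trans ?_
      rw [← nsmul_eq_mul]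
      refine Finset.sum_le_card_nsmul _ _ _ fun p _ => ?_
      rw [norm_mul, norm_star]
      refine (mul_le_of_le_one_left (norm_nonneg _) (hle _ _)).trans ?_
      exact (norm_le_pi_norm (R.net A (insert u I) (γ p.1)) _).trans
        (norm_le_pi_norm (R.net A (insert u I)) _)

/-- The set of contractions over a subtree is closed. -/
lemma IsUpper.exists_net_eq_of_tendsto {I : Finset (Fin n)} (hI : R.IsUpper I)
    (A : ℕ → ∀ i : Fin n, Ω.LocalIdx r i → D → ℂ) (X : Ω.GlobalIdx r → (Fin n → D) → ℂ)
    (hX : Tendsto (fun k => R.net (A k) I) atTop (𝓝 X)) :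
    ∃ B : ∀ i : Fin n, Ω.LocalIdx r i → D → ℂ, R.net B I = X := by
  classical
  induction hk : I.card using Nat.strong_induction_on generalizing I A X with
  | _ m ih =>
  have hlim : ∀ α j, Tendsto (fun k => R.net (A k) I α j) atTop (𝓝 (X α j)) := fun α j =>
    tendsto_pi_nhds.1 (tendsto_pi_nhds.1 hX α) j
  rcases I.eq_empty_or_nonempty with rfl | hne
  · have hroot : ∀ (B : ∀ i : Fin n, Ω.LocalIdx r i → D → ℂ) α j,
        R.net B ∅ α j = B v (Ω.restrict α v) (j v) := by
      intro B α j
      have hs : (Finset.univ.filter fun α' : Ω.GlobalIdx r =>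
          ∀ F, F ∉ (∅ : Finset (Fin n)).image R.edge → α' F = α F) = {α} := by
        ext α'
        simp [funext_iff]
      rw [net, hs]
      simp
    have hdep : ∀ α α' j j', Ω.restrict α v = Ω.restrict α' v → j v = j' v → X α j = X α' j' := by
      intro α α' j j' h1 h2
      refine tendsto_nhds_unique (hlim α j) ?_
      have : (fun k => R.net (A k) ∅ α j) = fun k => R.net (A k) ∅ α' j' := by
        funext k
        rw [hroot, hroot, h1, h2]
      rw [this]
      exact hlim α' j'
    -- The limit depends only on the data at the root, so any global extension of the local data may
    -- be chosen.
    let b : Ω.LocalIdx r v → D → ℂ := fun β x =>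
      if h : ∃ p : Ω.GlobalIdx r × (Fin n → D), Ω.restrict p.1 v = β ∧ p.2 v = x then
        X h.choose.1 h.choose.2 else 0
    refine ⟨Function.update (fun _ _ _ => 0) v b, ?_⟩
    funext α j
    rw [hroot, Function.update_self]
    have h : ∃ p : Ω.GlobalIdx r × (Fin n → D), Ω.restrict p.1 v = Ω.restrict α v ∧
      p.2 v = j v := ⟨(α, j), rfl, rfl⟩
    simp only [b, dif_pos h]
    exact hdep _ _ _ _ h.choose_spec.1 h.choose_spec.2
  · obtain ⟨u, J, rfl, hcard, hleaf⟩ := hI.exists_leaf hne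
    choose q A' hq hA' hbound using fun k => hleaf.exists_orthogonalized (A k)
    obtain ⟨C, hC⟩ := hX.norm.bddAbove_range
    have hC' : ∀ k, ‖R.net (A k) (insert u J)‖ ≤ C := fun k => hC ⟨k, rfl⟩
    have hC0 : 0 ≤ C := (norm_nonneg _).trans (hC' 0)
    set M : ℝ := max 1 (Fintype.card (Ω.LocalIdx r u × D) * C) with hM
    have hM0 : 0 ≤ M := zero_le_one.trans (le_max_left _ _)
    -- Compactness is applied to the leaf tensor and the contraction of the rest. The tensors `A' k`
    -- need not be bounded; the induction hypothesis replaces them.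
    let z : ℕ → (Ω.LocalIdx r u → D → ℂ) × (Ω.GlobalIdx r → (Fin n → D) → ℂ) :=
      fun k => (q k, R.net (A' k) J)
    have hz : ∀ k, z k ∈ Metric.closedBall
        (0 : (Ω.LocalIdx r u → D → ℂ) × (Ω.GlobalIdx r → (Fin n → D) → ℂ)) M := by
      intro k
      rw [mem_closedBall_zero_iff, norm_prod_le_iff]
      constructor
      · refine (pi_norm_le_iff_of_nonneg hM0).2 fun β => (pi_norm_le_iff_of_nonneg hM0).2 fun x => ?_
        exact (hq k β x).trans (le_max_left _ _)
      · refine (pi_norm_le_iff_of_nonneg hM0).2 fun α => (pi_norm_le_iff_of_nonneg hM0).2 fun j => ?_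
        refine (hbound k α j).trans (le_trans ?_ (le_max_right _ _))
        exact mul_le_mul_of_nonneg_left (hC' k) (Nat.cast_nonneg _)
    obtain ⟨⟨q₀, Y⟩, -, φ, hφ, hzlim⟩ := tendsto_subseq_of_bounded Metric.isBounded_closedBall hz
    rw [Prod.tendsto_iff] at hzlim
    obtain ⟨hqlim, hYlim⟩ := hzlim
    obtain ⟨B, hB⟩ := ih J.card (hk ▸ hcard) hleaf.isUpper (fun k => A' (φ k)) Y hYlim rfl
    refine ⟨Function.update B u q₀, ?_⟩
    funext α j
    refine tendsto_nhds_unique ?_ ((hlim α j).comp hφ.tendsto_atTop)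
    have hcongr : ∀ α, R.net (Function.update B u q₀) J α j = Y α j := by
      intro α
      rw [← hB]
      refine net_congr (fun i hi => ?_) (fun _ _ _ _ => rfl) (fun _ _ => rfl)
      rw [Function.update_of_ne]
      rintro rfl
      exact hleaf.notMem hi
    rw [hleaf.net_insert]
    simp_rw [hcongr, Function.update_self, Function.comp_def, hA']
    refine tendsto_finsetSum _ fun b _ => Tendsto.mul ?_ ?_
    · exact tendsto_pi_nhds.1 (tendsto_pi_nhds.1 hqlim _) _
    · exact tendsto_pi_nhds.1 (tendsto_pi_nhds.1 hYlim _) _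

end WSC.Rooting

namespace WSC

variable {n d d' r : ℕ} {Ω : WSC n}

lemma IsTree.exists_isMatrixDecomp_of_tendsto (hΩ : Ω.IsTree) {L : ℕ → MultiMatrix n d d'}
    {L₀ : MultiMatrix n d d'} (hL : Tendsto L atTop (𝓝 L₀))
    (h : ∀ k, ∃ A : ∀ i : Fin n, Ω.LocalIdx r i → Matrix (Fin d) (Fin d') ℂ,
      Ω.IsMatrixDecomp r A (L k)) :
    ∃ A : ∀ i : Fin n, Ω.LocalIdx r i → Matrix (Fin d) (Fin d') ℂ, Ω.IsMatrixDecomp r A L₀ := by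
  classical
  obtain ⟨v⟩ := hΩ.graph_isTree.connected.nonempty
  obtain ⟨R⟩ := hΩ.exists_rooting v
  choose A hA using h
  have hent : ∀ j k, Tendsto (fun m => L m j k) atTop (𝓝 (L₀ j k)) := fun j k =>
    tendsto_pi_nhds.1 (tendsto_pi_nhds.1 hL j) k
  obtain ⟨F₀, hF₀⟩ := Ω.exists_facetCopy_mem v
  rcases isEmpty_or_nonempty (Fin r) with hr | ⟨⟨a₀⟩⟩
  · have : IsEmpty (Ω.GlobalIdx r) := ⟨fun α => hr.elim (α F₀)⟩
    refine ⟨fun _ _ => 0, ?_⟩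
    have hz : ∀ m, L m = 0 := fun m => by
      have h1 : L m = _ := hA m
      rw [h1]
      simp
    rw [IsMatrixDecomp]
    simp only [Finset.univ_eq_empty, Finset.sum_empty]
    refine tendsto_nhds_unique hL ?_
    rw [show L = fun _ => 0 from funext hz]
    exact tendsto_const_nhds
  rcases subsingleton_or_nontrivial (Fin n) with hn | hn
  -- With one vertex the facet is not a parent edge, so `net` would not sum over it. Here the whole
  -- limit is placed at a single index.
  · refine ⟨fun i β => if β = fun _ => a₀ then
      Matrix.of fun x y => L₀ (fun _ => x) (fun _ => y) else 0, ?_⟩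
    ext j k
    rw [Matrix.sum_apply, Finset.sum_eq_single fun _ => a₀]
    · simp only [elemMatrix, Matrix.of_apply]
      have : Unique (Fin n) := ⟨⟨v⟩, fun a => Subsingleton.elim _ _⟩
      rw [Fintype.prod_unique]
      have h1 : Ω.restrict (fun _ => a₀) (default : Fin n) = fun _ => a₀ := rfl
      rw [if_pos h1, Matrix.of_apply]
      congr 1 <;> funext i <;> rw [Subsingleton.elim i default]
    · intro α _ hα
      simp only [elemMatrix, Matrix.of_apply]
      refine Finset.prod_eq_zero (Finset.mem_univ v) ?_
      rw [if_neg]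
      · rfl
      · intro hcon
        refine hα (funext fun F => ?_)
        obtain ⟨i, hi⟩ := F.1.2.nonempty v
        have hiv : i = v := Subsingleton.elim _ _
        subst hiv
        exact congrFun hcon ⟨F, hi⟩
    · simp
  · have hI : R.IsUpper (Finset.univ.erase v) := ⟨by simp, fun w _ => by simp⟩
    let B : ℕ → ∀ i : Fin n, Ω.LocalIdx r i → Fin d × Fin d' → ℂ := fun m i β x =>
      A m i β x.1 x.2
    -- Every facet is now a parent edge, so no index stays open. A pair of matrix indices serves as
    -- one physical index.
    have hfull : ∀ (B : ∀ i : Fin n, Ω.LocalIdx r i → Fin d × Fin d' → ℂ) α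
        (j : Fin n → Fin d × Fin d'), R.net B (Finset.univ.erase v) α j =
        ∑ α' : Ω.GlobalIdx r, ∏ i, B i (Ω.restrict α' i) (j i) := by
      intro B α j
      rw [Rooting.net, Finset.insert_erase (Finset.mem_univ v), Finset.filter_true_of_mem]
      intro α' _ F hF
      obtain ⟨u, hu, hF'⟩ := hΩ.exists_edge_eq R hn F
      exact absurd (Finset.mem_image.2 ⟨u, by simp [hu], hF'⟩) hF
    have hdec : ∀ m j k, L m j k = ∑ α' : Ω.GlobalIdx r, ∏ i,
        A m i (Ω.restrict α' i) (j i) (k i) := by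
      intro m j k
      have h1 : L m = _ := hA m
      rw [h1, Matrix.sum_apply]
      rfl
    obtain ⟨B₀, hB₀⟩ := hI.exists_net_eq_of_tendsto B
      (fun _ j => L₀ (fun i => (j i).1) fun i => (j i).2) (by
        refine tendsto_pi_nhds.2 fun α => tendsto_pi_nhds.2 fun j => ?_
        simp_rw [hfull]
        have := hent (fun i => (j i).1) fun i => (j i).2
        simp_rw [hdec] at this
        exact this)
    refine ⟨fun i β => Matrix.of fun x y => B₀ i β (x, y), ?_⟩
    ext j k
    have h1 := congrFun (congrFun hB₀ fun _ => a₀) fun i => (j i, k i)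
    rw [hfull] at h1
    rw [Matrix.sum_apply]
    exact h1.symm

end WSC

/-! ### Purifications as Gram decompositions -/

namespace WSC

variable {n d d' r : ℕ} {Ω : WSC n}

/-- `ρ` is the contraction of a family of psd matrices, each of which carries two copies of the
local indices. -/
def HasGramDecomp (Ω : WSC n) (r : ℕ) (ρ : MultiMatrix n d d) : Prop :=
  ∃ B : ∀ i : Fin n, Matrix (Ω.LocalIdx r i × Fin d) (Ω.LocalIdx r i × Fin d) ℂ,
    (∀ i, (B i).PosSemidef) ∧
    ∀ j k : Fin n → Fin d, ρ j k = ∑ α : Ω.GlobalIdx r, ∑ α' : Ω.GlobalIdx r,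
      ∏ i, B i (Ω.restrict α i, j i) (Ω.restrict α' i, k i)

lemma IsMatrixDecomp.mul_conjTranspose_apply
    {A : ∀ i : Fin n, Ω.LocalIdx r i → Matrix (Fin d) (Fin d') ℂ} {L : MultiMatrix n d d'}
    (h : Ω.IsMatrixDecomp r A L) (j k : Fin n → Fin d) :
    (L * Lᴴ) j k = ∑ α : Ω.GlobalIdx r, ∑ α' : Ω.GlobalIdx r,
      ∏ i, (A i (Ω.restrict α i) * (A i (Ω.restrict α' i))ᴴ) (j i) (k i) := by
  have h1 : L = _ := h
  rw [h1, Matrix.conjTranspose_sum, Matrix.sum_mul]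
  simp only [Matrix.mul_sum, conjTranspose_elemMatrix, elemMatrix_mul, Matrix.sum_apply]
  rfl

lemma HasPurification.hasGramDecomp {ρ : MultiMatrix n d d} (h : Ω.HasPurification r ρ) :
    Ω.HasGramDecomp r ρ := by
  obtain ⟨d', L, A, rfl, hA⟩ := h
  let M : ∀ i : Fin n, Matrix (Ω.LocalIdx r i × Fin d) (Fin d') ℂ := fun i =>
    Matrix.of fun p x => A i p.1 p.2 x
  refine ⟨fun i => M i * (M i)ᴴ, fun i => Matrix.posSemidef_self_mul_conjTranspose _,
    fun j k => ?_⟩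
  rw [hA.mul_conjTranspose_apply]
  rfl

/-- The dimension of an auxiliary space that suffices for all purifications of size `r`. -/
noncomputable def puriDim (Ω : WSC n) (r d : ℕ) : ℕ :=
  Fintype.card (Σ i : Fin n, Ω.LocalIdx r i × Fin d)

/-- Auxiliary dimensions may vary along a sequence, while the psd matrices `B i` have fixed size.
Factoring them, and embedding each factor into its own summand of a common sigma type, gives one
dimension for all. -/
lemma HasGramDecomp.exists_purification {ρ : MultiMatrix n d d} (h : Ω.HasGramDecomp r ρ) :
    ∃ (L : MultiMatrix n d (Ω.puriDim r d))
      (A : ∀ i : Fin n, Ω.LocalIdx r i → Matrix (Fin d) (Fin (Ω.puriDim r d)) ℂ),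
      ρ = L * Lᴴ ∧ Ω.IsMatrixDecomp r A L := by
  classical
  obtain ⟨B, hB, hρ⟩ := h
  choose C hC using fun i => (hB i).exists_eq_mul_conjTranspose
  let e : Fin (Ω.puriDim r d) ≃ Σ i : Fin n, Ω.LocalIdx r i × Fin d :=
    (Fintype.equivFin (Σ i : Fin n, Ω.LocalIdx r i × Fin d)).symm
  let c : ∀ i : Fin n, Ω.LocalIdx r i × Fin d → (Σ i : Fin n, Ω.LocalIdx r i × Fin d) → ℂ :=
    fun i p s => if h : s.1 = i then C i p (h ▸ s.2) else 0
  let A : ∀ i : Fin n, Ω.LocalIdx r i → Matrix (Fin d) (Fin (Ω.puriDim r d)) ℂ :=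
    fun i β => Matrix.of fun x y => c i (β, x) (e y)
  have hmul : ∀ i β β' x x', (A i β * (A i β')ᴴ) x x' = B i (β, x) (β', x') := by
    intro i β β' x x'
    rw [hC i, Matrix.mul_apply, Matrix.mul_apply]
    simp only [Matrix.conjTranspose_apply, A, Matrix.of_apply]
    rw [Equiv.sum_comp e fun s => c i (β, x) s * star (c i (β', x') s), Fintype.sum_sigma,
      Finset.sum_eq_single i]
    · simp [c]
    · intro k _ hk
      simp [c, hk]
    · simp
  refine ⟨∑ α : Ω.GlobalIdx r, elemMatrix fun i => A i (Ω.restrict α i), A, ?_, rfl⟩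
  ext j k
  rw [IsMatrixDecomp.mul_conjTranspose_apply (A := A) rfl, hρ]
  simp only [hmul]

lemma hasPurification_iff {ρ : MultiMatrix n d d} :
    Ω.HasPurification r ρ ↔ Ω.HasGramDecomp r ρ := by
  refine ⟨HasPurification.hasGramDecomp, fun h => ?_⟩
  obtain ⟨L, A, h1, h2⟩ := h.exists_purification
  exact ⟨_, L, A, h1, h2⟩

/-- Psd matrices labelled by `j` are the diagonal blocks of one psd matrix. Conversely, only such
blocks contribute to the diagonal entries of `ρ`. -/
lemma hasPsdDecomp_iff {T : Tensor n d} :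
    Ω.HasPsdDecomp r T ↔ Ω.HasPurification r (Matrix.diagonal T : MultiMatrix n d d) := by
  rw [hasPurification_iff]
  constructor
  · rintro ⟨E, hE, hT⟩
    refine ⟨fun i => Matrix.blockDiagonal (E i), fun i => ?_, fun j k => ?_⟩
    · choose C hC using fun x => (hE i x).exists_eq_mul_conjTranspose
      have : Matrix.blockDiagonal (E i) =
          Matrix.blockDiagonal C * (Matrix.blockDiagonal C)ᴴ := by
        rw [Matrix.blockDiagonal_conjTranspose, ← Matrix.blockDiagonal_mul]
        congr 1
        funext x
        exact hC x
      simp only [this]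
      exact Matrix.posSemidef_self_mul_conjTranspose _
    · by_cases h : j = k
      · subst h
        simp [hT, Matrix.blockDiagonal_apply]
      · rw [Matrix.diagonal_apply_ne _ h]
        obtain ⟨i, hi⟩ := Function.ne_iff.1 h
        symm
        refine Finset.sum_eq_zero fun α _ => Finset.sum_eq_zero fun α' _ =>
          Finset.prod_eq_zero (Finset.mem_univ i) ?_
        simp only [Matrix.blockDiagonal_apply, if_neg hi]
  · rintro ⟨B, hB, hT⟩
    refine ⟨fun i x => (B i).submatrix (fun β => (β, x)) fun β => (β, x),
      fun i x => (hB i).submatrix _, fun j => ?_⟩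
    have := hT j j
    rw [Matrix.diagonal_apply_eq] at this
    exact this

lemma psdRank_eq_puriRank (T : Tensor n d) :
    Ω.psdRank T = Ω.puriRank (Matrix.diagonal T : MultiMatrix n d d) := by
  simp only [psdRank, puriRank, hasPsdDecomp_iff]

lemma IsTree.hasPurification_of_tendsto (hΩ : Ω.IsTree) {u : ℕ → MultiMatrix n d d}
    {ρ : MultiMatrix n d d} (hu : Tendsto u atTop (𝓝 ρ)) (h : ∀ k, Ω.HasPurification r (u k)) :
    Ω.HasPurification r ρ := by
  choose L A hL hA using fun k => (h k).hasGramDecomp.exists_purification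
  have hent : ∀ j k, Tendsto (fun m => u m j k) atTop (𝓝 (ρ j k)) := fun j k =>
    tendsto_pi_nhds.1 (tendsto_pi_nhds.1 hu j) k
  choose C hC using fun j : Fin n → Fin d => (hent j j).norm.bddAbove_range
  have hC' : ∀ j k, ‖u k j j‖ ≤ C j := fun j k => hC j ⟨k, rfl⟩
  have hC0 : ∀ j, 0 ≤ C j := fun j => (norm_nonneg _).trans (hC' j 0)
  -- The squared row norms of `L k` are diagonal entries of `u k`. The summand one ensures `M ≤ M ^
  -- 2`, so a bound on squares bounds the entries.
  set M : ℝ := 1 + ∑ j, C j with hM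
  have hM1 : 1 ≤ M := le_add_of_nonneg_right (Finset.sum_nonneg fun j _ => hC0 j)
  have hM0 : 0 ≤ M := zero_le_one.trans hM1
  let z : ℕ → (Fin n → Fin d) → (Fin n → Fin (Ω.puriDim r d)) → ℂ := fun k j x => L k j x
  have hz : ∀ k, z k ∈ Metric.closedBall
      (0 : (Fin n → Fin d) → (Fin n → Fin (Ω.puriDim r d)) → ℂ) M := by
    intro k
    rw [mem_closedBall_zero_iff]
    refine (pi_norm_le_iff_of_nonneg hM0).2 fun j => (pi_norm_le_iff_of_nonneg hM0).2 fun x => ?_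
    change ‖L k j x‖ ≤ M
    have h1 : u k j j = ((∑ x, ‖L k j x‖ ^ 2 : ℝ) : ℂ) := by
      rw [hL k, Matrix.mul_apply]
      push_cast
      refine Finset.sum_congr rfl fun x _ => ?_
      rw [Matrix.conjTranspose_apply, Complex.star_def, Complex.mul_conj']
    have h2 := hC' j k
    rw [h1, Complex.norm_real, Real.norm_of_nonneg (Finset.sum_nonneg fun _ _ => sq_nonneg _)] at h2
    have h3 : ‖L k j x‖ ^ 2 ≤ ∑ x, ‖L k j x‖ ^ 2 :=
      Finset.single_le_sum (f := fun x => ‖L k j x‖ ^ 2) (fun _ _ => sq_nonneg _)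
        (Finset.mem_univ x)
    have h4 : C j ≤ ∑ j, C j := Finset.single_le_sum (fun j _ => hC0 j) (Finset.mem_univ j)
    refine le_of_sq_le_sq ?_ hM0
    nlinarith
  obtain ⟨L₀, -, φ, hφ, hlim⟩ := tendsto_subseq_of_bounded Metric.isBounded_closedBall hz
  have hlim' : Tendsto (fun k => L (φ k)) atTop (𝓝 (Matrix.of L₀)) := hlim
  obtain ⟨A₀, hA₀⟩ := hΩ.exists_isMatrixDecomp_of_tendsto hlim' fun k => ⟨A (φ k), hA (φ k)⟩
  refine ⟨_, Matrix.of L₀, A₀, ?_, hA₀⟩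
  refine tendsto_nhds_unique (hu.comp hφ.tendsto_atTop) ?_
  have hcont : Continuous fun M : MultiMatrix n d (Ω.puriDim r d) => M * Mᴴ :=
    continuous_id.matrix_mul continuous_id.matrix_conjTranspose
  have := (hcont.tendsto (Matrix.of L₀)).comp hlim'
  refine this.congr fun k => ?_
  exact (hL (φ k)).symm

end WSC

/-! ### The main theorem -/

theorem mainTheorem2 {n d : ℕ} (Ω : WSC n) (hΩ : Ω.IsTree) :
    (∀ T : Tensor n d, (∀ j, 0 ≤ T j) → borderRank Ω.nnRank T = Ω.nnRank T) ∧
    (∀ T : Tensor n d, (∀ j, 0 ≤ T j) → borderRank Ω.psdRank T = Ω.psdRank T) ∧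
    (∀ ρ : MultiMatrix n d d, IsSeparableMatrix ρ → borderRank Ω.sepRank ρ = Ω.sepRank ρ) ∧
    (∀ ρ : MultiMatrix n d d, ρ.PosSemidef → borderRank Ω.puriRank ρ = Ω.puriRank ρ) ∧
    (∀ (ρ : MultiMatrix n d d) (r : ℕ), IsSeparableMatrix ρ → Ω.sepRank ρ ≤ r → traceNorm ρ ≤ 1 →
      ∃ A : ∀ i : Fin n, Ω.LocalIdx r i → Matrix (Fin d) (Fin d) ℂ,
        Ω.IsSepDecomp r A ρ ∧ ∀ i β, traceNorm (A i β) ≤ 1) ∧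
    (∀ (ρ : MultiMatrix n d d) (r : ℕ) (v : Fin n), IsSeparableMatrix ρ → Ω.sepRank ρ ≤ r →
      ∃ A : ∀ i : Fin n, Ω.LocalIdx r i → Matrix (Fin d) (Fin d) ℂ,
        Ω.IsSepDecomp r A ρ ∧
        (∀ i, i ≠ v → ∀ β, (A i β).trace.re ≤ 1) ∧
        ∑ β : Ω.LocalIdx r v, (A v β).trace = ρ.trace) := by
  obtain ⟨v₀⟩ := hΩ.graph_isTree.connected.nonempty
  obtain ⟨R₀⟩ := hΩ.exists_rooting v₀
  have hdiag : Continuous fun T : Tensor n d => (Matrix.diagonal T : MultiMatrix n d d) :=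
    continuous_id.matrix_diagonal
  refine ⟨fun T _ => ?_, fun T _ => ?_, fun ρ _ => ?_, fun ρ _ => ?_, ?_, ?_⟩
  · refine borderRank_eq fun r u hu hr => ?_
    simp only [WSC.nnRank_eq_sepRank, WSC.sepRank_le_iff v₀] at hr ⊢
    exact WSC.HasSepDecomp.of_tendsto R₀ ((hdiag.tendsto T).comp hu) hr
  · refine borderRank_eq fun r u hu hr => ?_
    simp only [WSC.psdRank_eq_puriRank, WSC.puriRank_le_iff v₀] at hr ⊢
    exact hΩ.hasPurification_of_tendsto ((hdiag.tendsto T).comp hu) hr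
  · refine borderRank_eq fun r u hu hr => ?_
    simp only [WSC.sepRank_le_iff v₀] at hr ⊢
    exact WSC.HasSepDecomp.of_tendsto R₀ hu hr
  · refine borderRank_eq fun r u hu hr => ?_
    simp only [WSC.puriRank_le_iff v₀] at hr ⊢
    exact hΩ.hasPurification_of_tendsto hu hr
  · intro ρ r hρ hr htr
    obtain ⟨A, hA, hA1, hAv⟩ := ((WSC.sepRank_le_iff v₀).1 hr).exists_normalized R₀
    refine ⟨A, hA, fun i β => ?_⟩
    rw [traceNorm_of_posSemidef hρ.posSemidef, ← hAv, Complex.re_sum] at htr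
    rw [traceNorm_of_posSemidef (hA.2 i β)]
    -- Any root works: at the root the traces sum to the trace norm of `ρ`, which is at most one,
    -- and elsewhere the normalization applies.
    by_cases hi : i = v₀
    · subst hi
      refine le_trans ?_ htr
      exact Finset.single_le_sum (f := fun β => (A i β).trace.re)
        (fun β _ => (Complex.nonneg_iff.1 (hA.2 i β).trace_nonneg).1) (Finset.mem_univ β)
    · exact hA1 i hi β
  · intro ρ r v _ hr
    obtain ⟨R⟩ := hΩ.exists_rooting v
    exact ((WSC.sepRank_le_iff v).1 hr).exists_normalized R
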